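/- Let $\mathcal A$ be a unital $C^*$-algebra, $\mathcal B\subseteq\mathcal A$ a $C^*$-subalgebra containing $1_{\mathcal A}$, $E:\mathcal A\to\mathcal B$ a completely positive linear map with $E(b_1ab_2)=b_1E(a)b_2$ and $E(b)=b$ for $b,b_1,b_2\in\mathcal B$, $a\in\mathcal A$, and $E':\mathcal A\to\mathcal B$ a bounded linear map with $E'(1)=0$, $E'(a^*)=E'(a)^*$ and $E'(b_1ab_2)=b_1E'(a)b_2$ (that is, $(\mathcal A,\mathcal B,E,E')$ is a $C^*$-operator-valued infinitesimal probability space). Let $x=x^*$ and $y=y^*$ in $\mathcal A$ be infinitesimally free, i.e. for the unital algebras $\mathcal A_1,\mathcal A_2$ generated by $\mathcal B\cup\{x\}$ and by $\mathcal B\cup\{y\}$: whenever $n\ge1$, $i_1\ne i_2\ne\cdots\ne i_n$ (neighbouring indices in $\{1,2\}$ are distinct), $a_j\in\mathcal A_{i_j}$ and $E(a_j)=0$ for all $j$, one has $$E(a_1\cdots a_n)=0,\qquad E'(a_1\cdots a_n)=\sum_{j=1}^nE\big(a_1\cdots a_{j-1}E'(a_j)a_{j+1}\cdots a_n\big).$$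 Assume that $E(x)$ and $E(y)$ are invertible in $\mathcal B$. For $z\in\mathcal A$ and small $b\in\mathcal B$ put $\psi_z(b)=E\big((1-bz)^{-1}-1\big)$ and $\partial\psi_z(b)=E'\big((1-bz)^{-1}-1\big)$. If $E(z)$ is invertible, let $\psi_z^{\langle-1\rangle}$ be the compositional inverse of $\psi_z$ near $0$ and, for small $w\in\mathcal B$, $$S_z(w)=w^{-1}(1+w)\,\psi_z^{\langle-1\rangle}(w),\qquad \partial S_z(w)=-w^{-1}(1+w)\,\big(\psi_z^{\langle-1\rangle}\big)'(w)\Big(\partial\psi_z\big(\psi_z^{\langle-1\rangle}(w)\big)\Big),$$ $$T_z(w)=S_z(w)^{-1},\qquad \partial T_z(w)=-T_z(w)\,\partial S_z(w)\,T_z(w),$$ where $'$ is the Fréchet derivative and $w\mapsto w^{-1}f(w)$ denotes the analytic germ $g$ at $0$ with $w\,g(w)=f(w)$. Then for $z\in\{x,y,xy\}$ these transforms are well defined near $0$ (with $\psi_z^{\langle -1\rangle}$, $S_z$, $\partial S_z$ analytic and $S_z(w)$ invertible), and for all $w\in\mathcal B$ with $\|w\|$ small enough $$\partial T_{xy}(w)=T_x\big(T_y(w)wT_y(w)^{-1}\big)\,\partial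 T_y(w)+T_x'\big(T_y(w)wT_y(w)^{-1}\big)(C)\,T_y(w)+\partial T_x\big(T_y(w)wT_y(w)^{-1}\big)\,T_y(w),$$ where $$C=-T_y(w)wT_y(w)^{-1}\,\partial T_y(w)\,T_y(w)^{-1}+\partial T_y(w)\,w\,T_y(w)^{-1}.$$ -/

import Mathlib

open Topology

noncomputable section

/-! ### `C*`-operator-valued infinitesimal probability spaces -/

/-- The data `(E, E')` which make a unital `C*`-algebra `A` and a star subalgebra `B` containing the
unit (closed, by a separate hypothesis) a `C*`-operator-valued infinitesimal probability space:
`E : A → B` is a completely positive `B`-bimodule map restricting to the identity on `B`, and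
`E' : A → B` is a bounded self-adjoint `B`-bimodule map with `E'(1) = 0`. -/
structure CStarOVISpace (A : Type*) [CStarAlgebra A] [PartialOrder A] [StarOrderedRing A]
    (B : StarSubalgebra ℂ A) where
  /-- the conditional expectation -/
  E : A →ₗ[ℂ] B
  E_coe : ∀ b : B, E (b : A) = b
  E_bimodule : ∀ (b₁ : B) (a : A) (b₂ : B), E (b₁ * a * b₂) = b₁ * E a * b₂
  /-- complete positivity; positivity in `M_k(B)` is positivity in `M_k(A)` -/
  E_cp : ∀ (k : ℕ) (M : CStarMatrix (Fin k) (Fin k) A), 0 ≤ M →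
    0 ≤ M.map (fun a => (E a : A))
  /-- the infinitesimal expectation -/
  E' : A →L[ℂ] B
  E'_one : E' 1 = 0
  E'_bimodule : ∀ (b₁ : B) (a : A) (b₂ : B), E' (b₁ * a * b₂) = b₁ * E' a * b₂
  E'_star : ∀ a : A, E' (star a) = star (E' a)

/-! ### Local inverses and quotients of germs of analytic functions -/

section Germs

variable {R : Type*} [NormedRing R] [NormedAlgebra ℂ R]

open Classical in
/-- The compositional inverse `f^{⟨-1⟩}`, near `f 0`, given by the inverse function theorem at `0`
(with value `0` if that theorem does not apply). -/
def compInverse [CompleteSpace R] (f : R → R) : R → R :=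
  if h : ∃ f' : R ≃L[ℂ] R, HasStrictFDerivAt f (f' : R →L[ℂ] R) 0 then
    h.choose_spec.localInverse f h.choose 0
  else 0

/-- `g` is the analytic function `b ↦ b⁻¹ f(b)` near `0`: it is analytic at `0` and satisfies
`b g(b) = f(b)` for all small `b`. As small invertible `b` form a nonempty open set, the germ of
`g` at `0` is determined by that of `f`; this gives `b⁻¹ f(b)` its meaning at those small `b` which
are not invertible. -/
def IsLeftQuotient (f g : R → R) : Prop :=
  AnalyticAt ℂ g 0 ∧ ∀ᶠ b in 𝓝 (0 : R), b * g b = f b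

open Classical in
/-- The analytic function `b ↦ b⁻¹ f(b)` near `0` (with value `0` if there is none). -/
def leftQuotient (f : R → R) : R → R :=
  if h : ∃ g, IsLeftQuotient f g then h.choose else 0

end Germs

namespace CStarOVISpace

variable {A : Type*} [CStarAlgebra A] [PartialOrder A] [StarOrderedRing A]
  {B : StarSubalgebra ℂ A} (P : CStarOVISpace A B)

/-! ### Infinitesimal freeness -/

/-- Infinitesimal freeness of a family of subalgebras (meant to contain `B`) with respect to
`(E, E')`. The words have length `n + 1 ≥ 1`. -/
def IsInfFreeFamily {ι : Type*} (𝒜 : ι → Subalgebra ℂ A) : Prop :=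
  ∀ (n : ℕ) (i : Fin (n + 1) → ι) (a : Fin (n + 1) → A),
    (∀ j : Fin n, i j.castSucc ≠ i j.succ) →
    (∀ j, a j ∈ 𝒜 (i j)) → (∀ j, P.E (a j) = 0) →
      P.E (List.ofFn a).prod = 0 ∧
      P.E' (List.ofFn a).prod =
        ∑ j, P.E (List.ofFn (Function.update a j (P.E' (a j) : A))).prod

/-- The unital algebra generated by `x` over `B`. -/
def algOver (B : StarSubalgebra ℂ A) (x : A) : Subalgebra ℂ A :=
  Algebra.adjoin ℂ ((B : Set A) ∪ {x})

/-- Infinitesimal freeness of two elements: the unital algebras which they generate over `B` are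
infinitesimally free. -/
def InfFree (x y : A) : Prop :=
  P.IsInfFreeFamily ![algOver B x, algOver B y]

/-! ### The transforms -/

/-- `ψ_x(b) = E((1 - b x)⁻¹ - 1)` -/
def psi (x : A) (b : B) : B := P.E (Ring.inverse (1 - (b : A) * x) - 1)

/-- `∂ψ_x(b) = E'((1 - b x)⁻¹ - 1)` -/
def dpsi (x : A) (b : B) : B := P.E' (Ring.inverse (1 - (b : A) * x) - 1)

variable [hB : IsClosed (B : Set A)]

instance instCompleteSpaceSubalgebra : CompleteSpace B := hB.completeSpace_coe

/-- `ψ_x^{⟨-1⟩}` -/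
def chi (x : A) : B → B := compInverse (P.psi x)

/-- `(1 + w) ψ_x^{⟨-1⟩}(w)`, which is `w S_x(w)` -/
def sNum (x : A) (w : B) : B := (1 + w) * P.chi x w

/-- `-(1 + w) (ψ_x^{⟨-1⟩})'(w)(∂ψ_x(ψ_x^{⟨-1⟩}(w)))`, which is `w ∂S_x(w)` -/
def dsNum (x : A) (w : B) : B :=
  -((1 + w) * fderiv ℂ (P.chi x) w (P.dpsi x (P.chi x w)))

/-- The `S`-transform `S_x(w) = w⁻¹ (1 + w) ψ_x^{⟨-1⟩}(w)`. -/
def S (x : A) : B → B := leftQuotient (P.sNum x)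

/-- The infinitesimal `S`-transform
`∂S_x(w) = -w⁻¹ (1 + w) (ψ_x^{⟨-1⟩})'(w)(∂ψ_x(ψ_x^{⟨-1⟩}(w)))`. -/
def dS (x : A) : B → B := leftQuotient (P.dsNum x)

/-- The `T`-transform `T_x(w) = S_x(w)⁻¹`. -/
def T (x : A) (w : B) : B := Ring.inverse (P.S x w)

/-- The infinitesimal `T`-transform `∂T_x(w) = -T_x(w) ∂S_x(w) T_x(w)`. -/
def dT (x : A) (w : B) : B := -(P.T x w * P.dS x w * P.T x w)

/-- The transforms of `x` really are what their names say near `0`, that is, none of the default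
values in the definitions above occurs: `ψ_x^{⟨-1⟩}` is analytic and inverse to `ψ_x` near `0`,
the analytic quotients which define `S_x` and `∂S_x` exist, and `S_x(w)` is invertible for
small `w`. -/
structure TransformsDefined (x : A) : Prop where
  psi_inv : ∀ᶠ b in 𝓝 (0 : B), IsUnit (1 - (b : A) * x)
  chi_zero : P.chi x 0 = 0
  chi_analytic : AnalyticAt ℂ (P.chi x) 0
  psi_chi : ∀ᶠ w in 𝓝 (0 : B), P.psi x (P.chi x w) = w
  chi_psi : ∀ᶠ b in 𝓝 (0 : B), P.chi x (P.psi x b) = b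
  isQuotient_S : IsLeftQuotient (P.sNum x) (P.S x)
  isQuotient_dS : IsLeftQuotient (P.dsNum x) (P.dS x)
  isUnit_S : ∀ᶠ w in 𝓝 (0 : B), IsUnit (P.S x w)

end CStarOVISpace

end

noncomputable section

/-! The formula is the `ε`-coefficient of the twisted multiplicativity `T_xy(w) = T_x(T_y(w) w
T_y(w)⁻¹) T_y(w)`, read over the dual numbers `A[ε]`, `ε² = 0`. There `E + εE'` is a `B[ε]`-bimodule
map, and infinitesimal freeness implies ordinary freeness for it, the sum over letters being the
Leibniz rule (`IsInfFreeFamily.dualE_prod`). The functions `S + ε∂S` and `T + ε∂T` are transforms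
for this expectation, because `-(ψ^{⟨-1⟩})'(∂ψ(ψ^{⟨-1⟩}))` is the first-order change of the inverse
of `ψ + ε∂ψ`.

Multiplicativity comes from factoring a resolvent. At `b = S_y(w) χ_x(T_y(w) w T_y(w)⁻¹)`, with its
`ε`-part included, `(1 - bxy)⁻¹ = (1 + wq)(1 - pq)⁻¹(1 + w + p)`, where `p` and `q` are centered and
built from the resolvents of `x` and of `y` (`resolvent_mul_one_sub`). These lie only in the
closures of the generated algebras, to which freeness extends by continuity. In the geometric series
freeness kills all but the constant part, so the expectation is `1 + w`
(`IsInfFreeFamily.dualE_geometric`). Hence `b` is the inverse of `ψ_xy + ε∂ψ_xy` at `w`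
(`InfFree.eventually_chi_mul`).

Passing to `S` means dividing by a possibly singular `w`. Existence of the quotients comes from
`ψ_z(b) = b φ_z(b)` with `φ_z(0) = E(z)` invertible; uniqueness comes from the identity theorem
(`IsLeftQuotient.eventuallyEq`). -/

theorem analyticAt_clm_apply {X V W : Type*} [NormedAddCommGroup X] [NormedSpace ℂ X]
    [NormedAddCommGroup V] [NormedSpace ℂ V] [NormedAddCommGroup W] [NormedSpace ℂ W]
    {f : X → V →L[ℂ] W} {g : X → V} {a : X} (hf : AnalyticAt ℂ f a) (hg : AnalyticAt ℂ g a) :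
    AnalyticAt ℂ (fun t => f t (g t)) a :=
  ((ContinuousLinearMap.id ℂ (V →L[ℂ] W)).analyticAt_bilinear (f a, g a)).comp₂ hf hg

/-! ### Uniqueness of analytic left quotients -/

section LeftQuotient

variable {R : Type*} [NormedRing R] [NormedAlgebra ℂ R]

theorem isLeftQuotient_leftQuotient {f g : R → R} (hg : IsLeftQuotient f g) :
    IsLeftQuotient f (leftQuotient f) := by
  have h : ∃ g, IsLeftQuotient f g := ⟨g, hg⟩
  rw [leftQuotient, dif_pos h]
  exact h.choose_spec

variable [CompleteSpace R]

/-- Where `b` is invertible, `b * (g - h) b = 0` can be cancelled. A small nonzero scalar multiple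
of `1` has a neighbourhood of such `b`, and the identity theorem spreads the vanishing over a ball
around `0`. -/
theorem IsLeftQuotient.eventuallyEq {f g h : R → R} (hg : IsLeftQuotient f g)
    (hh : IsLeftQuotient f h) : g =ᶠ[𝓝 0] h := by
  have hd : ∀ᶠ b in 𝓝 (0 : R), AnalyticAt ℂ (g - h) b ∧ b * (g - h) b = 0 := by
    filter_upwards [(hg.1.sub hh.1).eventually_analyticAt, hg.2, hh.2] with b h1 h2 h3
    exact ⟨h1, by simp [mul_sub, h2, h3]⟩
  obtain ⟨r, hr, hball⟩ := Metric.eventually_nhds_iff_ball.1 hd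
  have hcont : Filter.Tendsto (fun t : ℂ => t • (1 : R)) (𝓝[≠] 0) (𝓝 0) := by
    have : Filter.Tendsto (fun t : ℂ => t • (1 : R)) (𝓝 0) (𝓝 ((0 : ℂ) • (1 : R))) :=
      (continuous_id.smul continuous_const).tendsto 0
    rw [zero_smul] at this
    exact this.mono_left nhdsWithin_le_nhds
  obtain ⟨t, ht0, htr⟩ := ((eventually_nhdsWithin_of_forall (fun _ h => h)).and
    (hcont.eventually (Metric.ball_mem_nhds 0 hr))).exists
  have hu : IsUnit (t • (1 : R)) := by
    have : IsUnit (algebraMap ℂ R t) := (isUnit_iff_ne_zero.2 ht0).map (algebraMap ℂ R)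
    rwa [Algebra.algebraMap_eq_smul_one] at this
  have hz : (g - h) =ᶠ[𝓝 (t • (1 : R))] 0 := by
    filter_upwards [Metric.isOpen_ball.mem_nhds htr, Units.isOpen.mem_nhds hu] with b h1 h2
    exact (IsUnit.mul_right_eq_zero h2).1 (hball b h1).2
  have hA : AnalyticOnNhd ℂ (g - h) (Metric.ball 0 r) := fun b hb => (hball b hb).1
  have hE := hA.eqOn_of_preconnected_of_eventuallyEq (g := 0) (fun b _ => analyticAt_const)
    (convex_ball (0 : R) r).isPreconnected htr hz
  filter_upwards [Metric.ball_mem_nhds (0 : R) hr] with b hb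
  exact sub_eq_zero.1 (hE hb)

theorem leftQuotient_eventuallyEq {f g : R → R} (hg : IsLeftQuotient f g) :
    leftQuotient f =ᶠ[𝓝 0] g :=
  (isLeftQuotient_leftQuotient hg).eventuallyEq hg

/-! ### The compositional inverse of an analytic germ -/

theorem compInverse_spec {f : R → R} (hf : AnalyticAt ℂ f 0) (hf0 : f 0 = 0)
    (f' : R ≃L[ℂ] R) (hf' : HasFDerivAt f (f' : R →L[ℂ] R) 0) :
    compInverse f 0 = 0 ∧ AnalyticAt ℂ (compInverse f) 0 ∧
      (∀ᶠ w in 𝓝 (0 : R), f (compInverse f w) = w) ∧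
      ∀ᶠ b in 𝓝 (0 : R), compInverse f (f b) = b := by
  have hs : HasStrictFDerivAt f (f' : R →L[ℂ] R) 0 := by
    have := hf.hasStrictFDerivAt
    rwa [hf'.fderiv] at this
  have h : ∃ f' : R ≃L[ℂ] R, HasStrictFDerivAt f (f' : R →L[ℂ] R) 0 := ⟨f', hs⟩
  have hc : compInverse f = h.choose_spec.localInverse f h.choose 0 := by
    rw [compInverse, dif_pos h]
  have h1 := h.choose_spec.eventually_right_inverse
  have h2 := h.choose_spec.eventually_left_inverse
  have h3 := h.choose_spec.localInverse_apply_image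
  have h4 : AnalyticAt ℂ (h.choose_spec.localInverse f h.choose 0) (f 0) := by
    refine OpenPartialHomeomorph.analyticAt_symm' (f := h.choose_spec.toOpenPartialHomeomorph f)
      (i := h.choose) ?_ ?_ ?_
    · exact h.choose_spec.mem_toOpenPartialHomeomorph_source
    · exact hf
    · exact h.choose_spec.hasFDerivAt.fderiv
  rw [hf0] at h1 h3 h4
  rw [hc]
  exact ⟨h3, h4, h1, h2⟩

end LeftQuotient

/-! ### Boundedness and bimodule rules of the expectations -/

namespace CStarOVISpace

variable {A : Type*} [CStarAlgebra A] [PartialOrder A] [StarOrderedRing A]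
  {B : StarSubalgebra ℂ A} (P : CStarOVISpace A B)

theorem E_nonneg {a : A} (ha : 0 ≤ a) : 0 ≤ (P.E a : A) := by
  obtain ⟨c, rfl⟩ := CStarAlgebra.nonneg_iff_eq_star_mul_self.1 ha
  let e : A ≃⋆ₐ[ℂ] CStarMatrix (Fin 1) (Fin 1) A := CStarMatrix.toOneByOne (Fin 1) ℂ A
  have h := P.E_cp 1 (e (star c * c)) (by rw [map_mul, map_star]; exact star_mul_self_nonneg _)
  have h1 := map_nonneg e.symm h
  exact h1

/-- Positive maps between `C*`-algebras are automatically bounded, so continuity of `E` need not be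
assumed. -/
theorem exists_norm_E_le : ∃ C : ℝ, ∀ a, ‖P.E a‖ ≤ C * ‖a‖ := by
  let f : A →ₗ[ℂ] A := B.subtype.toLinearMap ∘ₗ P.E
  let g : A →ₚ[ℂ] A := PositiveLinearMap.mk₀ f fun a ha => P.E_nonneg ha
  obtain ⟨C, hC⟩ := g.exists_norm_apply_le
  exact ⟨C, hC⟩

/-- The conditional expectation as a continuous linear map. -/
def Ec : A →L[ℂ] B := P.E.mkContinuousOfExistsBound P.exists_norm_E_le

@[simp] theorem Ec_apply (a : A) : P.Ec a = P.E a := rfl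

theorem continuous_E : Continuous P.E := P.Ec.continuous

theorem E_one : P.E 1 = 1 := by simpa using P.E_coe 1

theorem E_mul_left (b : B) (a : A) : P.E (b * a) = b * P.E a := by
  simpa using P.E_bimodule b a 1

theorem E_mul_right (a : A) (b : B) : P.E (a * b) = P.E a * b := by
  simpa using P.E_bimodule 1 a b

theorem E'_mul_left (b : B) (a : A) : P.E' (b * a) = b * P.E' a := by
  simpa using P.E'_bimodule b a 1

theorem E'_coe (b : B) : P.E' (b : A) = 0 := by
  simpa [P.E'_one] using P.E'_mul_left b 1

end CStarOVISpace

namespace CStarOVISpace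

/-! ### Resolvents -/

section Resolvent

variable {A : Type*} [CStarAlgebra A] {B : StarSubalgebra ℂ A}

/-- The inclusion of `B` as a continuous linear map. -/
def incl (B : StarSubalgebra ℂ A) : B →L[ℂ] A :=
  ⟨B.subtype.toLinearMap, continuous_subtype_val⟩

@[simp] theorem incl_apply (b : B) : incl B b = (b : A) := rfl

/-- The resolvent `(1 - b z)⁻¹`. -/
def res (z : A) (b : B) : A := Ring.inverse (1 - (b : A) * z)

theorem eventually_isUnit_one_sub_mul (z : A) : ∀ᶠ a : A in 𝓝 0, IsUnit (1 - a * z) := by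
  have hc : Continuous fun a : A => 1 - a * z := by fun_prop
  exact (hc.continuousAt (x := 0)).eventually (Units.isOpen.mem_nhds (by simp))

theorem eventually_isUnit_one_sub (z : A) : ∀ᶠ b : B in 𝓝 0, IsUnit (1 - (b : A) * z) :=
  ((incl B).continuous.tendsto' 0 0 (map_zero _)).eventually (eventually_isUnit_one_sub_mul z)

theorem res_zero (z : A) : res z (0 : B) = 1 := by simp [res]

theorem analyticAt_res {z : A} {b : B} (hb : IsUnit (1 - (b : A) * z)) :
    AnalyticAt ℂ (res z) b := by
  obtain ⟨u, hu⟩ := hb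
  have h1 : AnalyticAt ℂ (fun b : B => 1 - incl B b * z) b :=
    analyticAt_const.sub (((incl B).analyticAt b).mul analyticAt_const)
  have h2 := analyticAt_inverse (𝕜 := ℂ) u
  rw [hu] at h2
  exact h2.comp_of_eq h1 rfl

theorem hasFDerivAt_res {z : A} {b : B} (hb : IsUnit (1 - (b : A) * z)) :
    ∃ L : B →L[ℂ] A, HasFDerivAt (res z) L b ∧ ∀ h : B, L h = res z b * (h * z) * res z b := by
  obtain ⟨u, hu⟩ := hb
  have h1 : HasFDerivAt (fun b : B => 1 - incl B b * z)
      (-((ContinuousLinearMap.mul ℂ A).flip z ∘L incl B)) b :=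
    ((((ContinuousLinearMap.mul ℂ A).flip z).hasFDerivAt).comp b
      (incl B).hasFDerivAt).const_sub 1
  have h2 := hasFDerivAt_ringInverse (𝕜 := ℂ) u
  rw [hu] at h2
  refine ⟨_, h2.comp b h1, fun h => ?_⟩
  simp [res, ← hu, mul_assoc]

theorem res_mul_one_sub {z : A} {b : B} (hb : IsUnit (1 - (b : A) * z)) :
    res z b * (1 - (b : A) * z) = 1 := Ring.inverse_mul_cancel _ hb

theorem one_sub_mul_res {z : A} {b : B} (hb : IsUnit (1 - (b : A) * z)) :
    (1 - (b : A) * z) * res z b = 1 := Ring.mul_inverse_cancel _ hb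

theorem res_eq {z : A} {b : B} (hb : IsUnit (1 - (b : A) * z)) :
    res z b = 1 + b * (z * res z b) := by
  have := one_sub_mul_res hb
  rw [sub_mul, one_mul, sub_eq_iff_eq_add, mul_assoc] at this
  exact this

theorem eventually_isUnit_one_add [IsClosed (B : Set A)] :
    ∀ᶠ w in 𝓝 (0 : B), IsUnit (1 + w) := by
  have hc : Continuous fun w : B => 1 + w := by fun_prop
  exact hc.continuousAt.eventually (Units.isOpen.mem_nhds (by simp))

end Resolvent

variable {A : Type*} [CStarAlgebra A] [PartialOrder A] [StarOrderedRing A]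
  {B : StarSubalgebra ℂ A} (P : CStarOVISpace A B)

/-- `E(z (1 - b z)⁻¹)`, so that `ψ_z(b) = b φ_z(b)`. -/
def phi (z : A) (b : B) : B := P.E (z * res z b)

/-- `E'(z (1 - b z)⁻¹)`, so that `∂ψ_z(b) = b ∂φ_z(b)`. -/
def dphi (z : A) (b : B) : B := P.E' (z * res z b)

theorem psi_eq {z : A} {b : B} (hb : IsUnit (1 - (b : A) * z)) :
    P.psi z b = b * P.phi z b := by
  rw [psi, phi, ← E_mul_left, ← res, res_eq hb, add_sub_cancel_left, ← res_eq hb]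

theorem dpsi_eq {z : A} {b : B} (hb : IsUnit (1 - (b : A) * z)) :
    P.dpsi z b = b * P.dphi z b := by
  rw [dpsi, dphi, ← E'_mul_left, ← res, res_eq hb, add_sub_cancel_left, ← res_eq hb]

theorem dpsi_eq_res (z : A) (b : B) : P.dpsi z b = P.E' (res z b) := by
  rw [dpsi, map_sub, P.E'_one, sub_zero, res]

theorem psi_eq_res (z : A) (b : B) : P.psi z b = P.E (res z b) - 1 := by
  rw [psi, map_sub, P.E_one, res]

theorem analyticAt_psi {z : A} {b : B} (hb : IsUnit (1 - (b : A) * z)) :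
    AnalyticAt ℂ (P.psi z) b :=
  P.Ec.analyticAt _ |>.comp ((analyticAt_res hb).sub analyticAt_const)

theorem analyticAt_phi {z : A} {b : B} (hb : IsUnit (1 - (b : A) * z)) :
    AnalyticAt ℂ (P.phi z) b :=
  P.Ec.analyticAt _ |>.comp (analyticAt_const.mul (analyticAt_res hb))

theorem fderiv_psi {z : A} {b : B} (hb : IsUnit (1 - (b : A) * z)) (h : B) :
    fderiv ℂ (P.psi z) b h = P.E (res z b * (h * z) * res z b) := by
  obtain ⟨L, hL, hL'⟩ := hasFDerivAt_res hb
  have : HasFDerivAt (P.psi z) (P.Ec ∘L L) b :=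
    P.Ec.hasFDerivAt.comp b (hL.sub_const 1)
  rw [this.fderiv]
  simp [hL']

/-- Product rule for `ψ_z(b) = b φ_z(b)`. At `b = 0` it leaves right multiplication by `E(z)`; in
general it isolates the terms divisible by `b` on the left. -/
theorem fderiv_psi_eq {z : A} {b : B} (hb : IsUnit (1 - (b : A) * z)) (h : B) :
    fderiv ℂ (P.psi z) b h = h * P.phi z b + b * P.E (z * (res z b * (h * z) * res z b)) := by
  rw [P.fderiv_psi hb, phi, ← E_mul_left, ← E_mul_left, ← map_add]
  congr 1
  calc res z b * (h * z) * res z b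
      = (1 + b * (z * res z b)) * (h * z) * res z b := by rw [← res_eq hb]
    _ = _ := by noncomm_ring

theorem phi_zero (z : A) : P.phi z 0 = P.E z := by simp [phi, res_zero]

theorem psi_zero (z : A) : P.psi z 0 = 0 := by simp [psi]

variable [IsClosed (B : Set A)]

/-! ### The transforms of an element with invertible expectation -/

section Transforms

variable {z : A}

theorem chi_spec (hz : IsUnit (P.E z)) :
    P.chi z 0 = 0 ∧ AnalyticAt ℂ (P.chi z) 0 ∧
      (∀ᶠ w in 𝓝 (0 : B), P.psi z (P.chi z w) = w) ∧
      ∀ᶠ b in 𝓝 (0 : B), P.chi z (P.psi z b) = b := by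
  obtain ⟨u, hu⟩ := hz
  let m : B →L[ℂ] B →L[ℂ] B := (ContinuousLinearMap.mul ℂ B).flip
  let e : B ≃L[ℂ] B := ContinuousLinearEquiv.equivOfInverse (m u) (m ↑u⁻¹)
    (fun b => by simp [m]) (fun b => by simp [m])
  have h0 : IsUnit (1 - ((0 : B) : A) * z) := by simp
  have ha := P.analyticAt_psi h0
  refine compInverse_spec ha (P.psi_zero z) e ?_
  have hd := ha.differentiableAt.hasFDerivAt
  have he : fderiv ℂ (P.psi z) 0 = e := by
    refine ContinuousLinearMap.ext fun h => ?_
    rw [P.fderiv_psi_eq h0, phi_zero, ← hu]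
    simp [e, m]
  rwa [he] at hd

theorem tendsto_chi (hz : IsUnit (P.E z)) : Filter.Tendsto (P.chi z) (𝓝 0) (𝓝 0) := by
  have := (P.chi_spec hz).2.1.continuousAt.tendsto
  rwa [(P.chi_spec hz).1] at this

theorem eventually_isUnit_one_sub_chi (hz : IsUnit (P.E z)) :
    ∀ᶠ w in 𝓝 (0 : B), IsUnit (1 - (P.chi z w : A) * z) :=
  (P.tendsto_chi hz).eventually (eventually_isUnit_one_sub (B := B) z)

variable (z) in
/-- `φ_z(χ_z(w))⁻¹`, so that `χ_z(w) = w κ_z(w)`. -/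
def kappa (w : B) : B := Ring.inverse (P.phi z (P.chi z w))

variable (z) in
/-- The infinitesimal part of `χ_z`. -/
def dchi (w : B) : B := -fderiv ℂ (P.chi z) w (P.dpsi z (P.chi z w))

variable (z) in
/-- The infinitesimal part of `κ_z`, so that `∂χ_z(w) = w ∂κ_z(w)`. -/
def dkappa (w : B) : B :=
  -(P.kappa z w * (P.dphi z (P.chi z w) +
    P.E (z * (res z (P.chi z w) * (P.dchi z w * z) * res z (P.chi z w)))) * P.kappa z w)

theorem eventually_isUnit_phi_chi (hz : IsUnit (P.E z)) :
    ∀ᶠ w in 𝓝 (0 : B), IsUnit (P.phi z (P.chi z w)) := by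
  have h0 : IsUnit (1 - ((0 : B) : A) * z) := by simp
  have := (P.analyticAt_phi h0).continuousAt.tendsto.comp (P.tendsto_chi hz)
  rw [phi_zero] at this
  exact this.eventually (Units.isOpen.mem_nhds hz)

theorem analyticAt_res_chi (hz : IsUnit (P.E z)) :
    AnalyticAt ℂ (fun w => res z (P.chi z w)) 0 := by
  exact (analyticAt_res (b := (0 : B)) (by simp)).comp_of_eq (P.chi_spec hz).2.1
    (P.chi_spec hz).1

theorem analyticAt_kappa (hz : IsUnit (P.E z)) : AnalyticAt ℂ (P.kappa z) 0 := by
  have h1 : AnalyticAt ℂ (fun w => P.phi z (P.chi z w)) 0 :=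
    P.Ec.analyticAt _ |>.comp (analyticAt_const.mul (P.analyticAt_res_chi hz))
  obtain ⟨u, hu⟩ := (P.eventually_isUnit_phi_chi hz).self_of_nhds
  have h2 := analyticAt_inverse (𝕜 := ℂ) u
  rw [hu] at h2
  exact h2.comp_of_eq h1 rfl

theorem analyticAt_dchi (hz : IsUnit (P.E z)) : AnalyticAt ℂ (P.dchi z) 0 := by
  have h1 : AnalyticAt ℂ (fun w => P.dpsi z (P.chi z w)) 0 :=
    P.E'.analyticAt _ |>.comp ((P.analyticAt_res_chi hz).sub analyticAt_const)
  exact (analyticAt_clm_apply (P.chi_spec hz).2.1.fderiv h1).neg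

theorem analyticAt_dkappa (hz : IsUnit (P.E z)) : AnalyticAt ℂ (P.dkappa z) 0 := by
  have h1 := P.analyticAt_res_chi hz
  have h2 := P.analyticAt_kappa hz
  have h3 : AnalyticAt ℂ (fun w => P.dphi z (P.chi z w)) 0 :=
    P.E'.analyticAt _ |>.comp (analyticAt_const.mul h1)
  have h5 : AnalyticAt ℂ (fun w => (P.dchi z w : A)) 0 :=
    (incl B).analyticAt _ |>.comp (P.analyticAt_dchi hz)
  have h4 : AnalyticAt ℂ (fun w => P.E (z * (res z (P.chi z w) * (P.dchi z w * z) *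
      res z (P.chi z w)))) 0 :=
    P.Ec.analyticAt _ |>.comp
      (analyticAt_const.mul ((h1.mul (h5.mul analyticAt_const)).mul h1))
  exact ((h2.mul (h3.add h4)).mul h2).neg

/-- The derivatives of `ψ_z` and its inverse are inverse to each other. -/
theorem eventually_fderiv_psi_chi (hz : IsUnit (P.E z)) :
    ∀ᶠ w in 𝓝 (0 : B), ∀ h : B,
      fderiv ℂ (P.psi z) (P.chi z w) (fderiv ℂ (P.chi z) w h) = h ∧
      fderiv ℂ (P.chi z) w (fderiv ℂ (P.psi z) (P.chi z w) h) = h := by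
  obtain ⟨h0, ha, hr, hl⟩ := P.chi_spec hz
  filter_upwards [hr.eventually_nhds, hr, (P.tendsto_chi hz).eventually hl.eventually_nhds,
    ha.eventually_analyticAt, P.eventually_isUnit_one_sub_chi hz] with w h1 h1' h2 h3 h4 h
  have d1 := h3.differentiableAt.hasFDerivAt
  have d2 := (P.analyticAt_psi h4).differentiableAt.hasFDerivAt
  have e1 := ((d2.comp w d1).congr_of_eventuallyEq
    (h1.mono fun _ h => h.symm)).unique (hasFDerivAt_id w)
  have d1' : HasFDerivAt (P.chi z) (fderiv ℂ (P.chi z) w) (P.psi z (P.chi z w)) := by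
    rwa [h1']
  have e2 := ((d1'.comp _ d2).congr_of_eventuallyEq
    (h2.mono fun _ h => h.symm)).unique (hasFDerivAt_id _)
  exact ⟨DFunLike.congr_fun e1 h, DFunLike.congr_fun e2 h⟩

theorem eventually_chi_eq (hz : IsUnit (P.E z)) :
    ∀ᶠ w in 𝓝 (0 : B), P.chi z w = w * P.kappa z w := by
  filter_upwards [(P.chi_spec hz).2.2.1, P.eventually_isUnit_phi_chi hz,
    P.eventually_isUnit_one_sub_chi hz] with w h1 h2 h3
  rw [P.psi_eq h3] at h1
  calc P.chi z w = P.chi z w * P.phi z (P.chi z w) * P.kappa z w := by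
        rw [kappa, Ring.mul_inverse_cancel_right _ _ h2]
    _ = _ := by rw [h1]

/-- Solving the linearized equation `ψ'(χ)(∂χ) = -∂ψ(χ)` for `∂χ` leaves only terms with `χ = w κ`
on the left, which exhibits the factor `w` without inverting it. -/
theorem eventually_dchi_eq (hz : IsUnit (P.E z)) :
    ∀ᶠ w in 𝓝 (0 : B), P.dchi z w = w * P.dkappa z w := by
  filter_upwards [P.eventually_chi_eq hz, P.eventually_isUnit_phi_chi hz,
    P.eventually_isUnit_one_sub_chi hz, P.eventually_fderiv_psi_chi hz] with w h1 h2 h3 h4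
  have h5 : fderiv ℂ (P.psi z) (P.chi z w) (P.dchi z w) = -P.dpsi z (P.chi z w) := by
    rw [dchi, map_neg, (h4 _).1]
  rw [P.fderiv_psi_eq h3, P.dpsi_eq h3] at h5
  have h6 : P.phi z (P.chi z w) * P.kappa z w = 1 := Ring.mul_inverse_cancel _ h2
  set e := P.E (z * (res z (P.chi z w) * (P.dchi z w * z) * res z (P.chi z w)))
  calc P.dchi z w = P.dchi z w * (P.phi z (P.chi z w) * P.kappa z w) := by rw [h6, mul_one]
    _ = (P.dchi z w * P.phi z (P.chi z w) + P.chi z w * e) * P.kappa z w -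
        P.chi z w * e * P.kappa z w := by noncomm_ring
    _ = -(P.chi z w * (P.dphi z (P.chi z w) + e) * P.kappa z w) := by
        rw [h5]; noncomm_ring
    _ = -(w * P.kappa z w * (P.dphi z (P.chi z w) + e) * P.kappa z w) := by rw [← h1]
    _ = w * -(P.kappa z w * (P.dphi z (P.chi z w) + e) * P.kappa z w) := by noncomm_ring
    _ = _ := rfl

theorem isLeftQuotient_sNum (hz : IsUnit (P.E z)) :
    IsLeftQuotient (P.sNum z) (fun w => (1 + w) * P.kappa z w) := by
  refine ⟨(analyticAt_const.add analyticAt_id).mul (P.analyticAt_kappa hz), ?_⟩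
  filter_upwards [P.eventually_chi_eq hz] with w hw
  rw [sNum, hw]
  noncomm_ring

theorem isLeftQuotient_dsNum (hz : IsUnit (P.E z)) :
    IsLeftQuotient (P.dsNum z) (fun w => (1 + w) * P.dkappa z w) := by
  refine ⟨(analyticAt_const.add analyticAt_id).mul (P.analyticAt_dkappa hz), ?_⟩
  filter_upwards [P.eventually_dchi_eq hz] with w hw
  rw [dsNum, ← mul_neg, ← dchi, hw]
  noncomm_ring

theorem eventually_S_eq (hz : IsUnit (P.E z)) :
    ∀ᶠ w in 𝓝 (0 : B), P.S z w = (1 + w) * P.kappa z w :=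
  leftQuotient_eventuallyEq (P.isLeftQuotient_sNum hz)

theorem eventually_dS_eq (hz : IsUnit (P.E z)) :
    ∀ᶠ w in 𝓝 (0 : B), P.dS z w = (1 + w) * P.dkappa z w :=
  leftQuotient_eventuallyEq (P.isLeftQuotient_dsNum hz)

theorem eventually_isUnit_S (hz : IsUnit (P.E z)) : ∀ᶠ w in 𝓝 (0 : B), IsUnit (P.S z w) := by
  filter_upwards [P.eventually_S_eq hz, P.eventually_isUnit_phi_chi hz,
    eventually_isUnit_one_add] with w h1 h2 h3
  rw [h1]
  exact h3.mul h2.ringInverse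

theorem transformsDefined (hz : IsUnit (P.E z)) : P.TransformsDefined z where
  -- The variable of this field ranges over a neighbourhood of `0` in `A`, the zero of `B` being
  -- coerced, so the version over `A` applies.
  psi_inv := eventually_isUnit_one_sub_mul z
  chi_zero := (P.chi_spec hz).1
  chi_analytic := (P.chi_spec hz).2.1
  psi_chi := (P.chi_spec hz).2.2.1
  chi_psi := (P.chi_spec hz).2.2.2
  isQuotient_S := isLeftQuotient_leftQuotient (P.isLeftQuotient_sNum hz)
  isQuotient_dS := isLeftQuotient_leftQuotient (P.isLeftQuotient_dsNum hz)
  isUnit_S := P.eventually_isUnit_S hz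

end Transforms

end CStarOVISpace

/-! ### Dual numbers over a ring -/

section DualNumbers

open TrivSqZeroExt

variable {A : Type*} [Ring A]

/-- The dual number `a + ε c`. -/
def dual (a c : A) : TrivSqZeroExt A A := inl a + inr c

@[simp] theorem fst_dual (a c : A) : (dual a c).fst = a := by simp [dual]

@[simp] theorem snd_dual (a c : A) : (dual a c).snd = c := by simp [dual]

theorem dual_fst_snd (t : TrivSqZeroExt A A) : dual t.fst t.snd = t := inl_fst_add_inr_snd_eq t

theorem dual_mul (a c a' c' : A) : dual a c * dual a' c' = dual (a * a') (a * c' + c * a') := by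
  ext <;> simp

theorem dual_add (a c a' c' : A) : dual a c + dual a' c' = dual (a + a') (c + c') := by
  ext <;> simp

theorem dual_sub (a c a' c' : A) : dual a c - dual a' c' = dual (a - a') (c - c') := by
  ext <;> simp

theorem dual_one_zero : dual (1 : A) 0 = 1 := by
  ext <;> simp

theorem continuous_dual [TopologicalSpace A] [ContinuousAdd A] :
    Continuous fun s : A × A => dual s.1 s.2 :=
  (TrivSqZeroExt.continuous_inl.comp _root_.continuous_fst).add
    (TrivSqZeroExt.continuous_inr.comp _root_.continuous_snd)

/-- The Leibniz rule: as `ε² = 0`, exactly one letter contributes its `ε`-part. This matches the sum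
in the definition of infinitesimal freeness. -/
theorem snd_list_ofFn_prod {n : ℕ} (a : Fin n → TrivSqZeroExt A A) :
    (List.ofFn a).prod.snd =
      ∑ j, (List.ofFn (Function.update (fun k => (a k).fst) j (a j).snd)).prod := by
  induction n with
  | zero => simp
  | succ n ih =>
    rw [List.ofFn_succ, List.prod_cons, snd_mul, ih, Fin.sum_univ_succ, add_comm]
    congr 1
    · rw [List.ofFn_succ, List.prod_cons, Function.update_self, fst_list_prod, List.map_ofFn]
      simp [Function.update_of_ne, Function.comp_def]
    · rw [smul_eq_mul, Finset.mul_sum]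
      refine Finset.sum_congr rfl fun j _ => ?_
      rw [List.ofFn_succ, List.prod_cons, Function.update_of_ne (Fin.succ_ne_zero j).symm]
      congr 3
      ext k
      by_cases h : k = j
      · subst h; simp
      · simp [h]

theorem list_ofFn_prod_update_add {n : ℕ} (a : Fin n → A) (j : Fin n) (b c : A) :
    (List.ofFn (Function.update a j (b + c))).prod =
      (List.ofFn (Function.update a j b)).prod + (List.ofFn (Function.update a j c)).prod :=
  (MultilinearMap.mkPiAlgebraFin ℤ n A).map_update_add a j b c

/-- The list product of `p, q, p, q, …` with `n` factors. -/
def altProd {M : Type*} [Monoid M] (p q : M) (n : ℕ) : M :=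
  (List.ofFn fun j : Fin n => if Even (j : ℕ) then p else q).prod

theorem altProd_succ {M : Type*} [Monoid M] (p q : M) (n : ℕ) :
    altProd p q (n + 1) = p * altProd q p n := by
  rw [altProd, List.ofFn_succ, List.prod_cons, altProd]
  congr 3
  ext j
  simp only [Fin.val_succ, Nat.even_add_one, ite_not]

theorem altProd_two_mul {M : Type*} [Monoid M] (p q : M) (n : ℕ) :
    altProd p q (2 * n) = (p * q) ^ n := by
  induction n with
  | zero => simp [altProd]
  | succ n ih => rw [mul_add, mul_one, altProd_succ, altProd_succ, ih, pow_succ', mul_assoc]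

theorem altProd_two_mul_add_one {M : Type*} [Monoid M] (p q : M) (n : ℕ) :
    altProd p q (2 * n + 1) = p * (q * p) ^ n := by
  rw [altProd_succ, altProd_two_mul]

end DualNumbers

namespace CStarOVISpace

open TrivSqZeroExt

variable {A : Type*} [CStarAlgebra A] [PartialOrder A] [StarOrderedRing A]
  {B : StarSubalgebra ℂ A} (P : CStarOVISpace A B)

/-! ### The expectation on dual numbers -/

/-- The map `E + ε E'` on dual numbers. -/
def dualE : TrivSqZeroExt A A →+ TrivSqZeroExt A A where
  toFun t := dual (P.E t.fst : A) (P.E' t.fst + P.E t.snd : B)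
  map_zero' := by ext <;> simp
  map_add' s t := by
    ext
    · simp
    · simp only [fst_add, snd_add, map_add, snd_dual, AddMemClass.coe_add]
      abel

theorem dualE_apply (t : TrivSqZeroExt A A) :
    P.dualE t = dual (P.E t.fst : A) (P.E' t.fst + P.E t.snd : B) := rfl

theorem continuous_dualE : Continuous P.dualE := by
  have h1 : Continuous fun t : TrivSqZeroExt A A => (P.E t.fst : A) :=
    continuous_subtype_val.comp (P.continuous_E.comp TrivSqZeroExt.continuous_fst)
  have h2 : Continuous fun t : TrivSqZeroExt A A => ((P.E' t.fst + P.E t.snd : B) : A) :=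
    continuous_subtype_val.comp ((P.E'.continuous.comp TrivSqZeroExt.continuous_fst).add
      (P.continuous_E.comp TrivSqZeroExt.continuous_snd))
  exact continuous_dual.comp (h1.prodMk h2)

theorem dualE_bimodule (b c : B) (t : TrivSqZeroExt A A) (b' c' : B) :
    P.dualE (dual (b : A) c * t * dual (b' : A) c') =
      dual (b : A) c * P.dualE t * dual (b' : A) c' := by
  ext
  · simp [dualE_apply, P.E_bimodule]
  · simp only [dualE_apply, fst_mul, snd_mul, fst_dual, snd_dual, smul_eq_mul,
      MulOpposite.smul_eq_mul_unop, MulOpposite.unop_op, P.E'_bimodule, map_add, add_mul,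
      P.E_bimodule]
    push_cast
    noncomm_ring

theorem dualE_coe (b c : B) : P.dualE (dual (b : A) c) = dual (b : A) c := by
  simp [dualE_apply, P.E_coe, P.E'_coe]

theorem dualE_one : P.dualE 1 = 1 := by
  simpa [dual_one_zero] using P.dualE_coe 1 0

theorem dualE_mul_left (b c : B) (t : TrivSqZeroExt A A) :
    P.dualE (dual (b : A) c * t) = dual (b : A) c * P.dualE t := by
  simpa [dual_one_zero] using P.dualE_bimodule b c t 1 0

theorem dualE_mul_right (t : TrivSqZeroExt A A) (b c : B) :
    P.dualE (t * dual (b : A) c) = P.dualE t * dual (b : A) c := by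
  simpa [dual_one_zero] using P.dualE_bimodule 1 0 t b c

/-! ### Freeness of dual numbers -/

/-- The dual numbers with both components in the closure of a subalgebra. -/
def dualClosure (𝒜 : Subalgebra ℂ A) : Set (TrivSqZeroExt A A) :=
  {t | t.fst ∈ 𝒜.topologicalClosure ∧ t.snd ∈ 𝒜.topologicalClosure}

section Free

variable {P} {ι : Type*} {𝒜 : ι → Subalgebra ℂ A}

/-- Infinitesimal freeness is freeness with respect to `E + ε E'`. -/
theorem IsInfFreeFamily.dualE_prod (h : P.IsInfFreeFamily 𝒜) (hB : ∀ i, (B : Set A) ⊆ 𝒜 i)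
    {n : ℕ} (i : Fin (n + 1) → ι) (hi : ∀ j : Fin n, i j.castSucc ≠ i j.succ)
    (a : Fin (n + 1) → TrivSqZeroExt A A)
    (ha : ∀ j, (a j).fst ∈ 𝒜 (i j) ∧ (a j).snd ∈ 𝒜 (i j)) (ha0 : ∀ j, P.dualE (a j) = 0) :
    P.dualE (List.ofFn a).prod = 0 := by
  have hE : ∀ j, P.E (a j).fst = 0 := fun j => by
    have := congrArg fst (ha0 j)
    simpa [dualE_apply] using this
  have hE' : ∀ j, P.E' (a j).fst + P.E (a j).snd = 0 := fun j => by
    have := congrArg snd (ha0 j)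
    simpa only [dualE_apply, snd_dual, snd_zero, ZeroMemClass.coe_eq_zero] using this
  have hw := h n i (fun j => (a j).fst) hi (fun j => (ha j).1) hE
  have hfst : (List.ofFn a).prod.fst = (List.ofFn fun j => (a j).fst).prod := by
    rw [fst_list_prod, List.map_ofFn]; rfl
  -- The `ε`-part of `ha0 j` says that the new letter is centered for `E`, so plain freeness kills
  -- the word. Summed over `j`, these words give the whole `ε`-coefficient.
  have hz : ∀ j, P.E (List.ofFn (Function.update (fun k => (a k).fst) j
      ((P.E' (a j).fst : A) + (a j).snd))).prod = 0 := fun j => by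
    refine (h n i _ hi (fun k => ?_) (fun k => ?_)).1
    · rcases eq_or_ne k j with rfl | hk
      · rw [Function.update_self]
        exact add_mem (hB _ (P.E' (a k).fst).2) (ha k).2
      · rw [Function.update_of_ne hk]
        exact (ha k).1
    · rcases eq_or_ne k j with rfl | hk
      · rw [Function.update_self, map_add, P.E_coe]
        exact hE' k
      · rw [Function.update_of_ne hk]
        exact hE k
  rw [dualE_apply, hfst, hw.1, hw.2, snd_list_ofFn_prod, map_sum, ← Finset.sum_add_distrib]
  have : ∀ j, P.E (List.ofFn (Function.update (fun k => (a k).fst) j (P.E' (a j).fst : A))).prod +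
      P.E (List.ofFn (Function.update (fun k => (a k).fst) j (a j).snd)).prod = 0 := fun j => by
    rw [← map_add, ← list_ofFn_prod_update_add, hz j]
  rw [Finset.sum_eq_zero fun j _ => this j]
  ext <;> simp

/-- Approximants of a centered element need not be centered. The continuous map `s ↦ s - P.dualE s`
corrects them, fixes `t`, and stays in the algebra because it contains `B`. -/
theorem mem_closure_centered {𝒞 : Subalgebra ℂ A} (hB : (B : Set A) ⊆ 𝒞)
    {t : TrivSqZeroExt A A} (ht : t ∈ dualClosure 𝒞) (h0 : P.dualE t = 0) :
    t ∈ closure {s : TrivSqZeroExt A A | (s.fst ∈ 𝒞 ∧ s.snd ∈ 𝒞) ∧ P.dualE s = 0} := by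
  have h1 : t ∈ closure {s : TrivSqZeroExt A A | s.fst ∈ 𝒞 ∧ s.snd ∈ 𝒞} := by
    have : (t.fst, t.snd) ∈ closure ((𝒞 : Set A) ×ˢ (𝒞 : Set A)) := by
      rw [closure_prod_eq]
      exact ht
    have h2 := map_mem_closure continuous_dual this
      (t := {s : TrivSqZeroExt A A | s.fst ∈ 𝒞 ∧ s.snd ∈ 𝒞}) fun s hs => by simpa using hs
    simpa only [dual_fst_snd] using h2
  have hc : Continuous fun s => s - P.dualE s := continuous_id.sub P.continuous_dualE
  have h3 := map_mem_closure hc h1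
    (t := {s : TrivSqZeroExt A A | (s.fst ∈ 𝒞 ∧ s.snd ∈ 𝒞) ∧ P.dualE s = 0}) fun s hs => by
      refine ⟨⟨?_, ?_⟩, ?_⟩
      · simpa [dualE_apply] using sub_mem hs.1 (hB (P.E s.fst).2)
      · simp only [dualE_apply, snd_sub, snd_dual]
        exact sub_mem hs.2 (hB (P.E' s.fst + P.E s.snd).2)
      · rw [map_sub, P.dualE_apply s, dualE_coe, sub_self]
  simpa [h0] using h3

theorem IsInfFreeFamily.dualE_prod_closure (h : P.IsInfFreeFamily 𝒜)
    (hB : ∀ i, (B : Set A) ⊆ 𝒜 i)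
    {n : ℕ} (i : Fin (n + 1) → ι) (hi : ∀ j : Fin n, i j.castSucc ≠ i j.succ)
    (a : Fin (n + 1) → TrivSqZeroExt A A)
    (ha : ∀ j, a j ∈ dualClosure (𝒜 (i j))) (ha0 : ∀ j, P.dualE (a j) = 0) :
    P.dualE (List.ofFn a).prod = 0 := by
  have hmem : a ∈ closure (Set.pi Set.univ fun j =>
      {s : TrivSqZeroExt A A | (s.fst ∈ 𝒜 (i j) ∧ s.snd ∈ 𝒜 (i j)) ∧ P.dualE s = 0}) := by
    rw [closure_pi_set]
    exact fun j _ => mem_closure_centered (hB _) (ha j) (ha0 j)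
  have hc : Continuous fun a : Fin (n + 1) → TrivSqZeroExt A A => P.dualE (List.ofFn a).prod :=
    P.continuous_dualE.comp
      (ContinuousMultilinearMap.mkPiAlgebraFin ℂ (n + 1) (TrivSqZeroExt A A)).cont
  have hcl : IsClosed {a : Fin (n + 1) → TrivSqZeroExt A A | P.dualE (List.ofFn a).prod = 0} :=
    isClosed_eq hc continuous_const
  refine closure_minimal (fun a ha => ?_) hcl hmem
  exact h.dualE_prod hB i hi a (fun j => (ha j trivial).1) (fun j => (ha j trivial).2)

theorem IsInfFreeFamily.dualE_altProd (h : P.IsInfFreeFamily 𝒜) (hB : ∀ i, (B : Set A) ⊆ 𝒜 i)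
    {i j : ι} (hij : i ≠ j) {p q : TrivSqZeroExt A A} (hp : p ∈ dualClosure (𝒜 i))
    (hq : q ∈ dualClosure (𝒜 j)) (hp0 : P.dualE p = 0) (hq0 : P.dualE q = 0) (n : ℕ) :
    P.dualE (altProd p q (n + 1)) = 0 := by
  refine h.dualE_prod_closure hB (fun k => if Even (k : ℕ) then i else j) (fun k => ?_) _
    (fun k => ?_) (fun k => ?_)
  · by_cases hk : Even (k : ℕ)
    · simpa [hk, Nat.even_add_one] using hij
    · simpa [hk, Nat.even_add_one] using hij.symm
  · split_ifs <;> assumption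
  · split_ifs <;> assumption

/-- The expectation of the resolvent-type expression in two centered free elements. -/
theorem IsInfFreeFamily.dualE_geometric (h : P.IsInfFreeFamily 𝒜) (hB : ∀ i, (B : Set A) ⊆ 𝒜 i)
    {i j : ι} (hij : i ≠ j) {p q : TrivSqZeroExt A A} (hp : p ∈ dualClosure (𝒜 i))
    (hq : q ∈ dualClosure (𝒜 j)) (hp0 : P.dualE p = 0) (hq0 : P.dualE q = 0)
    (hpq : ‖p * q‖ < 1) (w : B) :
    P.dualE ((1 + dual (w : A) 0 * q) * Ring.inverse (1 - p * q) * (1 + dual (w : A) 0 + p)) =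
      1 + dual (w : A) 0 := by
  set W := dual (w : A) 0 with hW
  have hWl : ∀ t, P.dualE (W * t) = W * P.dualE t := fun t => by
    simpa using P.dualE_mul_left w 0 t
  have hWr : ∀ t, P.dualE (t * W) = P.dualE t * W := fun t => by
    simpa using P.dualE_mul_right t w 0
  have h1 : ∀ n, P.dualE ((p * q) ^ (n + 1)) = 0 := fun n => by
    rw [← altProd_two_mul]
    exact h.dualE_altProd hB hij hp hq hp0 hq0 (2 * n + 1)
  have h2 : ∀ n, P.dualE ((p * q) ^ n * p) = 0 := fun n => by
    rw [mul_pow_mul, ← altProd_two_mul_add_one]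
    exact h.dualE_altProd hB hij hp hq hp0 hq0 (2 * n)
  have h3 : ∀ n, P.dualE (q * (p * q) ^ n) = 0 := fun n => by
    rw [← altProd_two_mul_add_one]
    exact h.dualE_altProd hB hij.symm hq hp hq0 hp0 (2 * n)
  have h4 : ∀ n, P.dualE (q * (p * q) ^ n * p) = 0 := fun n => by
    rw [mul_assoc, mul_pow_mul, ← mul_assoc, ← pow_succ', ← altProd_two_mul]
    exact h.dualE_altProd hB hij.symm hq hp hq0 hp0 (2 * n + 1)
  have hG : HasSum (fun n : ℕ => (p * q) ^ n) (Ring.inverse (1 - p * q)) := by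
    rw [NormedRing.inverse_one_sub _ hpq]
    exact (summable_geometric_of_norm_lt_one hpq).hasSum
  have hS := ((hG.mul_left (1 + W * q)).mul_right (1 + W + p)).map P.dualE P.continuous_dualE
  -- Of the six words in the expansion only `(p * q) ^ n` and `(p * q) ^ n * W` can survive, and
  -- these vanish too unless `n = 0`.
  have hterm : ∀ n, P.dualE ((1 + W * q) * (p * q) ^ n * (1 + W + p)) =
      P.dualE ((p * q) ^ n) * (1 + W) := fun n => by
    have : (1 + W * q) * (p * q) ^ n * (1 + W + p) =
        (p * q) ^ n + (p * q) ^ n * W + (p * q) ^ n * p + W * (q * (p * q) ^ n) +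
          W * (q * (p * q) ^ n) * W + W * (q * (p * q) ^ n * p) := by noncomm_ring
    rw [this]
    simp only [map_add, hWl, hWr, h2, h3, h4]
    noncomm_ring
  refine hS.unique ?_
  have h0 := hasSum_single (f := P.dualE ∘ fun n : ℕ => (1 + W * q) * (p * q) ^ n * (1 + W + p)) 0
    (fun n hn => by
      obtain ⟨m, rfl⟩ := Nat.exists_eq_succ_of_ne_zero hn
      rw [Function.comp_apply, hterm, h1, zero_mul])
  rwa [Function.comp_apply, hterm, pow_zero, P.dualE_one, one_mul] at h0

end Free

end CStarOVISpace

/-! ### Factorization of the resolvent of a product -/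

section Factorization

variable {R : Type*} [Ring R]

/-- With `p = S (Rx - (1 + W')) Si` and `q = (K y Ry - 1) Wi`, the relations give `1 + W + p = S Rx
Si` and `1 + W q = Ry Wi`, and then `(S Rx Si)(1 - S U x y)(Ry Wi) = 1 - p q`. Inverting this
identity gives the resolvent of the product. -/
theorem resolvent_mul_one_sub {x y W W' S Si U V K Rx Ry Wi G : R}
    (hS : S = (1 + W) * K) (hSi : Si * S = 1) (hW' : W * S = S * W')
    (hV : V = W * K) (hWi : Wi * (1 + W) = 1) (hSi' : S * Si = 1) (hWi' : (1 + W) * Wi = 1)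
    (hRx : Rx * (1 - U * x) = 1) (hRy : (1 - V * y) * Ry = 1)
    (hRy₂ : Ry * (1 - V * y) = 1)
    (hG : G * (1 - S * (Rx - (1 + W')) * Si * ((K * y * Ry - 1) * Wi)) = 1) :
    (1 + W * ((K * y * Ry - 1) * Wi)) * G * (1 + W + S * (Rx - (1 + W')) * Si) *
      (1 - S * U * (x * y)) = 1 := by
  have hM : 1 + W + S * (Rx - (1 + W')) * Si = S * Rx * Si := by
    calc 1 + W + S * (Rx - (1 + W')) * Si
        = 1 + W + S * Rx * Si - S * Si - (S * W') * Si := by noncomm_ring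
      _ = 1 + W + S * Rx * Si - S * Si - W * (S * Si) := by rw [← hW']; noncomm_ring
      _ = S * Rx * Si := by rw [hSi']; noncomm_ring
  have hRy' : Ry = 1 + W * (K * y * Ry) := by
    have : Ry = (1 - V * y) * Ry + V * y * Ry := by noncomm_ring
    rw [hRy, hV] at this
    simpa [mul_assoc] using this
  have hN : (1 + W * ((K * y * Ry - 1) * Wi)) = Ry * Wi := by
    calc 1 + W * ((K * y * Ry - 1) * Wi)
        = 1 + (1 + W * (K * y * Ry)) * Wi - (1 + W) * Wi := by noncomm_ring
      _ = Ry * Wi := by rw [← hRy', hWi']; noncomm_ring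
  have hRU : Rx * U * x = Rx - 1 := by
    have : Rx * U * x = Rx - Rx * (1 - U * x) := by noncomm_ring
    rw [this, hRx]
  have hp : S * Rx * Si = 1 + W + S * (Rx - (1 + W')) * Si := hM.symm
  set p := S * (Rx - (1 + W')) * Si
  set k := K * y * Ry with hk
  have h1 : S * (Rx - 1) * Si = W + p := by
    calc S * (Rx - 1) * Si = S * Rx * Si - S * Si := by noncomm_ring
      _ = W + p := by rw [hp, hSi']; noncomm_ring
  -- The resolvent identity `Rx U x = Rx - 1` absorbs `x`; inserting `Si * S` then separates the
  -- `x`-part from the `y`-part.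
  have hmid : S * Rx * U * (x * y) * Ry = (W + p) * ((1 + W) * k) := by
    calc S * Rx * U * (x * y) * Ry = S * (Rx * U * x) * (1 * (y * Ry)) := by noncomm_ring
      _ = S * (Rx - 1) * (Si * S * (y * Ry)) := by rw [hRU, hSi]
      _ = (S * (Rx - 1) * Si) * (S * (y * Ry)) := by noncomm_ring
      _ = (W + p) * ((1 + W) * k) := by rw [h1, hS, hk]; noncomm_ring
  have hfac : (1 + W + p) * (1 - S * U * (x * y)) * (Ry * Wi) = 1 - p * ((k - 1) * Wi) := by
    rw [hM]
    calc S * Rx * Si * (1 - S * U * (x * y)) * (Ry * Wi)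
        = (S * Rx * Si * Ry - S * Rx * (Si * S) * U * (x * y) * Ry) * Wi := by noncomm_ring
      _ = (S * Rx * Si * Ry - S * Rx * U * (x * y) * Ry) * Wi := by rw [hSi, mul_one]
      _ = ((1 + W + p) * (1 + W * k) - (W + p) * ((1 + W) * k)) * Wi := by
          rw [hmid, hp, ← hRy']
      _ = (1 + W) * Wi - p * ((k - 1) * Wi) := by noncomm_ring
      _ = 1 - p * ((k - 1) * Wi) := by rw [hWi']
  have hinv : Ry * Wi * ((1 + W) * (1 - V * y)) = 1 := by
    calc Ry * Wi * ((1 + W) * (1 - V * y)) = Ry * (Wi * (1 + W)) * (1 - V * y) := by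
          simp only [mul_assoc]
      _ = 1 := by rw [hWi, mul_one, hRy₂]
  rw [hN]
  -- Multiplying on the right by `1`, in the form `hinv`, supplies the factor `Ry * Wi` that `hfac`
  -- requires.
  calc Ry * Wi * G * (1 + W + p) * (1 - S * U * (x * y))
      = Ry * Wi * G * (1 + W + p) * (1 - S * U * (x * y)) *
          (Ry * Wi * ((1 + W) * (1 - V * y))) := by rw [hinv, mul_one]
    _ = Ry * Wi * (G * ((1 + W + p) * (1 - S * U * (x * y)) * (Ry * Wi))) *
          ((1 + W) * (1 - V * y)) := by simp only [mul_assoc]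
    _ = 1 := by rw [hfac, hG, mul_one, hinv]

end Factorization

/-! ### Resolvents over the dual numbers -/

namespace CStarOVISpace

open TrivSqZeroExt

section Resolvent

variable {A : Type*} [CStarAlgebra A] {B : StarSubalgebra ℂ A}

/-- The resolvent `(1 - (b + ε c) z)⁻¹` over the dual numbers. -/
def dualRes (z : A) (b c : B) : TrivSqZeroExt A A :=
  dual (res z b) (res z b * (c * z) * res z b)

theorem dualRes_mul {z : A} {b : B} (hb : IsUnit (1 - (b : A) * z)) (c : B) :
    dualRes z b c * (1 - dual (b : A) c * dual z 0) = 1 := by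
  have h := res_mul_one_sub hb
  rw [dualRes, ← dual_one_zero, dual_mul, dual_sub, dual_mul, h]
  congr 1
  rw [mul_assoc (res z b * (c * z)), h]
  noncomm_ring

theorem mul_dualRes {z : A} {b : B} (hb : IsUnit (1 - (b : A) * z)) (c : B) :
    (1 - dual (b : A) c * dual z 0) * dualRes z b c = 1 := by
  have h := one_sub_mul_res hb
  rw [dualRes, ← dual_one_zero, dual_mul, dual_sub, dual_mul, h]
  congr 1
  rw [mul_assoc (res z b), ← mul_assoc (1 - (b : A) * z), h]
  noncomm_ring

theorem dualClosure_mul {𝒞 : Subalgebra ℂ A} {s t : TrivSqZeroExt A A} (hs : s ∈ dualClosure 𝒞)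
    (ht : t ∈ dualClosure 𝒞) : s * t ∈ dualClosure 𝒞 :=
  ⟨by simpa using mul_mem hs.1 ht.1,
    by simpa using add_mem (mul_mem hs.1 ht.2) (mul_mem hs.2 ht.1)⟩

theorem dualClosure_sub {𝒞 : Subalgebra ℂ A} {s t : TrivSqZeroExt A A} (hs : s ∈ dualClosure 𝒞)
    (ht : t ∈ dualClosure 𝒞) : s - t ∈ dualClosure 𝒞 :=
  ⟨by simpa using sub_mem hs.1 ht.1, by simpa using sub_mem hs.2 ht.2⟩

theorem coe_subset_algOver (z : A) : (B : Set A) ⊆ algOver B z :=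
  Set.subset_union_left.trans Algebra.subset_adjoin

theorem self_mem_algOver (z : A) : z ∈ algOver B z :=
  Algebra.subset_adjoin (Set.mem_union_right _ rfl)

theorem coe_mem_closure (z : A) (b : B) : (b : A) ∈ (algOver B z).topologicalClosure :=
  Subalgebra.le_topologicalClosure _ (coe_subset_algOver z b.2)

theorem self_mem_closure (z : A) : z ∈ (algOver B z).topologicalClosure :=
  Subalgebra.le_topologicalClosure _ (self_mem_algOver z)

theorem dual_coe_mem_dualClosure (z : A) (b c : B) :
    dual (b : A) c ∈ dualClosure (algOver B z) :=
  ⟨by simpa using coe_mem_closure z b, by simpa using coe_mem_closure z c⟩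

theorem dual_self_mem_dualClosure (z : A) : dual z 0 ∈ dualClosure (algOver B z) :=
  ⟨by simpa using self_mem_closure z, by simp⟩

theorem res_mem_closure {z : A} {b : B} (hb : ‖(b : A) * z‖ < 1) :
    res z b ∈ (algOver B z).topologicalClosure := by
  rw [res, NormedRing.inverse_one_sub _ hb]
  have hsum := (summable_geometric_of_norm_lt_one hb).hasSum
  have hcl : IsClosed ((algOver B z).topologicalClosure : Set A) :=
    Subalgebra.isClosed_topologicalClosure _
  refine hcl.mem_of_tendsto hsum (Filter.Eventually.of_forall fun s => ?_)
  exact sum_mem fun n _ => pow_mem (mul_mem (coe_mem_closure z b) (self_mem_closure z)) n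

theorem dualRes_mem_dualClosure {z : A} {b : B} (hb : ‖(b : A) * z‖ < 1) (c : B) :
    dualRes z b c ∈ dualClosure (algOver B z) := by
  have h := res_mem_closure hb
  refine ⟨by simpa [dualRes] using h, ?_⟩
  simpa [dualRes] using mul_mem (mul_mem h (mul_mem (coe_mem_closure z c) (self_mem_closure z))) h

theorem eventually_norm_mul_lt (z : A) : ∀ᶠ b : B in 𝓝 0, ‖(b : A) * z‖ < 1 := by
  have hc : Continuous fun b : B => ‖(b : A) * z‖ := by fun_prop
  exact (hc.tendsto' 0 0 (by simp)).eventually (gt_mem_nhds one_pos)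

theorem continuousAt_dual_coe {X : Type*} [TopologicalSpace X] {f g : X → B} {a : X}
    (hf : ContinuousAt f a) (hg : ContinuousAt g a) :
    ContinuousAt (fun t => dual (f t : A) (g t)) a :=
  continuous_dual.continuousAt.comp
    ((continuous_subtype_val.continuousAt.comp hf).prodMk
      (continuous_subtype_val.continuousAt.comp hg))

theorem continuousAt_dualRes {X : Type*} [TopologicalSpace X] {f g : X → B} {a : X} (z : A)
    (hf : ContinuousAt f a) (hg : ContinuousAt g a) (h0 : f a = 0) :
    ContinuousAt (fun t => dualRes z (f t) (g t)) a := by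
  have h1 : ContinuousAt (fun t => res z (f t)) a :=
    ContinuousAt.comp (f := f) (g := res z)
      (by rw [h0]; exact (analyticAt_res (by simp)).continuousAt) hf
  have h2 : ContinuousAt (fun t => (g t : A)) a := continuous_subtype_val.continuousAt.comp hg
  exact continuous_dual.continuousAt.comp
    (h1.prodMk ((h1.mul (h2.mul continuousAt_const)).mul h1))

end Resolvent

variable {A : Type*} [CStarAlgebra A] [PartialOrder A] [StarOrderedRing A]
  {B : StarSubalgebra ℂ A} (P : CStarOVISpace A B) [IsClosed (B : Set A)] {z : A}

/-- First-order form of `ψ(χ(w)) = w` at the dual number `w + εv`: the `v`-term is the chain rule,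
and `∂χ` cancels `∂ψ`. A general `v` is needed because the twisted argument has an `ε`-part. -/
theorem eventually_dualE_dualRes (hz : IsUnit (P.E z)) :
    ∀ᶠ w in 𝓝 (0 : B), ∀ v : B,
      P.dualE (dualRes z (P.chi z w) (fderiv ℂ (P.chi z) w v + P.dchi z w)) =
        1 + dual (w : A) v := by
  filter_upwards [(P.chi_spec hz).2.2.1, P.eventually_isUnit_one_sub_chi hz,
    P.eventually_fderiv_psi_chi hz] with w h1 h2 h3 v
  rw [psi_eq_res, sub_eq_iff_eq_add'] at h1
  rw [dualE_apply, dualRes, fst_dual, snd_dual, ← dual_one_zero, dual_add, zero_add, h1,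
    ← P.fderiv_psi h2, map_add, dchi, map_neg, (h3 _).1, (h3 _).1, dpsi_eq_res]
  congr 2
  abel

theorem eventually_dualE_kappa (hz : IsUnit (P.E z)) :
    ∀ᶠ w in 𝓝 (0 : B),
      P.dualE (dual (P.kappa z w : A) (P.dkappa z w) * dual z 0 *
        dualRes z (P.chi z w) (P.dchi z w)) = 1 := by
  filter_upwards [P.eventually_isUnit_phi_chi hz] with w h
  have h1 : P.kappa z w * P.phi z (P.chi z w) = 1 := Ring.inverse_mul_cancel _ h
  rw [mul_assoc, dualE_mul_left, dualRes, dual_mul z, dualE_apply, fst_dual, snd_dual, zero_mul,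
    add_zero, ← phi, ← dphi, dual_mul, ← dual_one_zero]
  congr 1
  · exact congrArg Subtype.val h1
  · norm_cast
    have h2 : P.dkappa z w * P.phi z (P.chi z w) = -(P.kappa z w * (P.dphi z (P.chi z w) +
        P.E (z * (res z (P.chi z w) * (P.dchi z w * z) * res z (P.chi z w))))) := by
      rw [dkappa, neg_mul, mul_assoc, h1, mul_one]
    rw [h2, add_neg_cancel]

end CStarOVISpace

/-! ### The twisted argument and the two centered factors -/

namespace CStarOVISpace

open TrivSqZeroExt

variable {A : Type*} [CStarAlgebra A] [PartialOrder A] [StarOrderedRing A]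
  {B : StarSubalgebra ℂ A} {P : CStarOVISpace A B}

/-- Expand the expectation of the centered word `(x - E(x))(y - E(y))`, which freeness makes zero.
-/
theorem InfFree.E_mul {x y : A} (h : P.InfFree x y) : P.E (x * y) = P.E x * P.E y := by
  have hx : x - P.E x ∈ algOver B x :=
    sub_mem (self_mem_algOver x) (coe_subset_algOver x (P.E x).2)
  have hy : y - P.E y ∈ algOver B y :=
    sub_mem (self_mem_algOver y) (coe_subset_algOver y (P.E y).2)
  have h1 := (h 1 ![0, 1] ![x - P.E x, y - P.E y] (by simp)
    (by simpa [Fin.forall_fin_two] using ⟨hx, hy⟩) (by simp [Fin.forall_fin_two, P.E_coe])).1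
  have h2 : (x - P.E x) * (y - P.E y) =
      x * y - x * (P.E y : A) - P.E x * y + (P.E x : A) * P.E y := by noncomm_ring
  have h3 : P.E ((P.E x : A) * P.E y) = P.E x * P.E y := by
    rw [P.E_mul_left, P.E_coe]
  simp only [List.ofFn_succ, Matrix.cons_val_zero, Matrix.cons_val_succ, List.ofFn_zero,
    List.prod_cons, List.prod_nil, mul_one] at h1
  rw [h2, map_add, map_sub, map_sub, P.E_mul_right, P.E_mul_left, h3, sub_add_cancel,
    sub_eq_zero] at h1
  exact h1

theorem InfFree.isUnit_E_mul (h : P.InfFree x y) (hx : IsUnit (P.E x)) (hy : IsUnit (P.E y)) :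
    IsUnit (P.E (x * y)) := by
  rw [h.E_mul]
  exact hx.mul hy

variable (P) [IsClosed (B : Set A)]

section Twist

variable {z : A}

theorem analyticAt_S (hz : IsUnit (P.E z)) : AnalyticAt ℂ (P.S z) 0 :=
  (P.transformsDefined hz).isQuotient_S.1

theorem analyticAt_dS (hz : IsUnit (P.E z)) : AnalyticAt ℂ (P.dS z) 0 :=
  (P.transformsDefined hz).isQuotient_dS.1

theorem analyticAt_T (hz : IsUnit (P.E z)) : AnalyticAt ℂ (P.T z) 0 := by
  obtain ⟨u, hu⟩ := (P.eventually_isUnit_S hz).self_of_nhds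
  have h2 := analyticAt_inverse (𝕜 := ℂ) u
  rw [hu] at h2
  exact h2.comp_of_eq (P.analyticAt_S hz) rfl

theorem analyticAt_dT (hz : IsUnit (P.E z)) : AnalyticAt ℂ (P.dT z) 0 :=
  (((P.analyticAt_T hz).mul (P.analyticAt_dS hz)).mul (P.analyticAt_T hz)).neg

variable (z) in
/-- `T_z(w) w T_z(w)⁻¹` -/
def twist (w : B) : B := P.T z w * w * P.S z w

variable (z) in
/-- The infinitesimal part of `T_z(w) w T_z(w)⁻¹`. -/
def dtwist (w : B) : B := P.T z w * w * P.dS z w + P.dT z w * w * P.S z w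

theorem analyticAt_twist (hz : IsUnit (P.E z)) : AnalyticAt ℂ (P.twist z) 0 :=
  ((P.analyticAt_T hz).mul analyticAt_id).mul (P.analyticAt_S hz)

theorem analyticAt_dtwist (hz : IsUnit (P.E z)) : AnalyticAt ℂ (P.dtwist z) 0 :=
  (((P.analyticAt_T hz).mul analyticAt_id).mul (P.analyticAt_dS hz)).add
    (((P.analyticAt_dT hz).mul analyticAt_id).mul (P.analyticAt_S hz))

theorem twist_zero : P.twist z 0 = 0 := by simp [twist]

theorem dtwist_zero : P.dtwist z 0 = 0 := by simp [dtwist]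

theorem tendsto_twist (hz : IsUnit (P.E z)) : Filter.Tendsto (P.twist z) (𝓝 0) (𝓝 0) := by
  have := (P.analyticAt_twist hz).continuousAt.tendsto
  rwa [twist_zero] at this

end Twist

variable {P} {x y : A}

variable (P x y) in
/-- The infinitesimal part of `χ_x(T_y(w) w T_y(w)⁻¹)`. -/
def dchiTwist (w : B) : B :=
  fderiv ℂ (P.chi x) (P.twist y w) (P.dtwist y w) + P.dchi x (P.twist y w)

theorem analyticAt_dchiTwist (hx : IsUnit (P.E x)) (hy : IsUnit (P.E y)) :
    AnalyticAt ℂ (P.dchiTwist x y) 0 := by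
  have h := P.analyticAt_twist hy
  exact (analyticAt_clm_apply ((P.chi_spec hx).2.1.fderiv.comp_of_eq h P.twist_zero)
    (P.analyticAt_dtwist hy)).add ((P.analyticAt_dchi hx).comp_of_eq h P.twist_zero)

theorem dchi_zero (hx : IsUnit (P.E x)) : P.dchi x 0 = 0 := by
  rw [(P.eventually_dchi_eq hx).self_of_nhds, zero_mul]

theorem dchiTwist_zero (hx : IsUnit (P.E x)) : P.dchiTwist x y 0 = 0 := by
  rw [dchiTwist, dtwist_zero, map_zero, twist_zero, dchi_zero hx, add_zero]

variable (P x y) in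
/-- The centered part of the resolvent of `x`, conjugated by `S_y(w)`, over the dual numbers. -/
def leftCentered (w : B) : TrivSqZeroExt A A :=
  dual (P.S y w : A) (P.dS y w) * (dualRes x (P.chi x (P.twist y w)) (P.dchiTwist x y w) -
    (1 + dual (P.twist y w : A) (P.dtwist y w))) * dual (P.T y w : A) (P.dT y w)

variable (P y) in
/-- The centered part of the resolvent of `y`, divided by `w` on the left and by `1 + w` on the
right, over the dual numbers. -/
def rightCentered (w : B) : TrivSqZeroExt A A :=
  (dual (P.kappa y w : A) (P.dkappa y w) * dual y 0 * dualRes y (P.chi y w) (P.dchi y w) - 1) *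
    dual ((Ring.inverse (1 + w) : B) : A) (0 : B)

theorem continuousAt_leftCentered (hx : IsUnit (P.E x)) (hy : IsUnit (P.E y)) :
    ContinuousAt (P.leftCentered x y) 0 := by
  have h1 := (P.analyticAt_twist hy).continuousAt
  have h2 : ContinuousAt (fun w => P.chi x (P.twist y w)) 0 :=
    ((P.chi_spec hx).2.1.comp_of_eq (P.analyticAt_twist hy) P.twist_zero).continuousAt
  have h3 : P.chi x (P.twist y 0) = 0 := by rw [twist_zero, (P.chi_spec hx).1]
  exact ((continuousAt_dual_coe (P.analyticAt_S hy).continuousAt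
    (P.analyticAt_dS hy).continuousAt).mul
    ((continuousAt_dualRes x h2 (analyticAt_dchiTwist hx hy).continuousAt h3).sub
      (continuousAt_const.add
        (continuousAt_dual_coe h1 (P.analyticAt_dtwist hy).continuousAt)))).mul
    (continuousAt_dual_coe (P.analyticAt_T hy).continuousAt (P.analyticAt_dT hy).continuousAt)

theorem leftCentered_zero (hx : IsUnit (P.E x)) : P.leftCentered x y 0 = 0 := by
  rw [leftCentered, twist_zero, (P.chi_spec hx).1, dchiTwist_zero hx, dtwist_zero, dualRes,
    res_zero]
  simp only [ZeroMemClass.coe_zero, zero_mul, mul_zero]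
  rw [← dual_one_zero, dual_add, add_zero, add_zero, sub_self, mul_zero, zero_mul]

theorem continuousAt_rightCentered (hy : IsUnit (P.E y)) :
    ContinuousAt (P.rightCentered y) 0 := by
  have h1 := (P.chi_spec hy).2.1.continuousAt
  have h2 : ContinuousAt (fun w : B => Ring.inverse (1 + w)) 0 := by
    have h3 := NormedRing.inverse_continuousAt (1 : Bˣ)
    have h4 : ContinuousAt (fun w : B => 1 + w) 0 := by fun_prop
    exact ContinuousAt.comp (g := Ring.inverse) (by simpa using h3) h4
  exact ((((continuousAt_dual_coe (P.analyticAt_kappa hy).continuousAt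
    (P.analyticAt_dkappa hy).continuousAt).mul continuousAt_const).mul
    (continuousAt_dualRes y h1 (P.analyticAt_dchi hy).continuousAt (P.chi_spec hy).1)).sub
      continuousAt_const).mul (continuousAt_dual_coe h2 continuousAt_const)

/-- Only the left factor vanishes at `w = 0`; continuity of the right factor suffices to make the
product small. -/
theorem eventually_norm_centered_lt (hx : IsUnit (P.E x)) (hy : IsUnit (P.E y)) :
    ∀ᶠ w in 𝓝 (0 : B), ‖P.leftCentered x y w * P.rightCentered y w‖ < 1 := by
  have h := ((continuousAt_leftCentered hx hy).mul (continuousAt_rightCentered hy)).norm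
  refine h.eventually (gt_mem_nhds ?_)
  simp [leftCentered_zero hx]

theorem eventually_leftCentered (hx : IsUnit (P.E x)) (hy : IsUnit (P.E y)) :
    ∀ᶠ w in 𝓝 (0 : B), P.leftCentered x y w ∈ dualClosure (algOver B x) ∧
      P.dualE (P.leftCentered x y w) = 0 := by
  filter_upwards [(P.tendsto_twist hy).eventually (P.eventually_dualE_dualRes hx),
    ((P.tendsto_chi hx).comp (P.tendsto_twist hy)).eventually (eventually_norm_mul_lt x)]
    with w h1 h2
  have h3 : (1 : TrivSqZeroExt A A) + dual (P.twist y w : A) (P.dtwist y w) =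
      dual ((1 + P.twist y w : B) : A) (P.dtwist y w) := by
    rw [← dual_one_zero, dual_add, zero_add]; rfl
  refine ⟨?_, ?_⟩
  · rw [leftCentered, h3]
    exact dualClosure_mul (dualClosure_mul (dual_coe_mem_dualClosure x _ _)
      (dualClosure_sub (dualRes_mem_dualClosure h2 _) (dual_coe_mem_dualClosure x _ _)))
      (dual_coe_mem_dualClosure x _ _)
  · rw [leftCentered, P.dualE_bimodule, map_sub, dchiTwist, h1, h3, P.dualE_coe, sub_self,
      mul_zero, zero_mul]

theorem eventually_rightCentered (hy : IsUnit (P.E y)) :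
    ∀ᶠ w in 𝓝 (0 : B), P.rightCentered y w ∈ dualClosure (algOver B y) ∧
      P.dualE (P.rightCentered y w) = 0 := by
  filter_upwards [P.eventually_dualE_kappa hy,
    (P.tendsto_chi hy).eventually (eventually_norm_mul_lt y)] with w h1 h2
  have h3 : (1 : TrivSqZeroExt A A) = dual ((1 : B) : A) (0 : B) := by
    rw [← dual_one_zero]; rfl
  refine ⟨?_, ?_⟩
  · rw [rightCentered, h3]
    exact dualClosure_mul (dualClosure_sub (dualClosure_mul (dualClosure_mul
      (dual_coe_mem_dualClosure y _ _) (dual_self_mem_dualClosure y))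
      (dualRes_mem_dualClosure h2 _)) (dual_coe_mem_dualClosure y _ _))
      (dual_coe_mem_dualClosure y _ _)
  · rw [rightCentered, P.dualE_mul_right, map_sub, h1, P.dualE_one, sub_self, zero_mul]

variable (P x y) in
/-- `S_y(w) χ_x(T_y(w) w T_y(w)⁻¹)` -/
def chiMul (w : B) : B := P.S y w * P.chi x (P.twist y w)

variable (P x y) in
/-- The infinitesimal part of `S_y(w) χ_x(T_y(w) w T_y(w)⁻¹)`. -/
def dchiMul (w : B) : B := P.S y w * P.dchiTwist x y w + P.dS y w * P.chi x (P.twist y w)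

theorem tendsto_chiMul (hx : IsUnit (P.E x)) (hy : IsUnit (P.E y)) :
    Filter.Tendsto (P.chiMul x y) (𝓝 0) (𝓝 0) := by
  have h := (P.analyticAt_S hy).continuousAt.tendsto.mul
    ((P.tendsto_chi hx).comp (P.tendsto_twist hy))
  rwa [mul_zero] at h

/-- The definition `∂T = -T ∂S T` is exactly what makes `T + ε∂T` the inverse of `S + ε∂S`. -/
theorem dual_S_mul_dual_T {w : B} (hw : IsUnit (P.S y w)) :
    dual (P.S y w : A) (P.dS y w) * dual (P.T y w : A) (P.dT y w) = 1 := by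
  have h : P.S y w * P.T y w = 1 := Ring.mul_inverse_cancel _ hw
  rw [dual_mul, ← dual_one_zero]
  norm_cast
  rw [dT, h]
  congr 1
  norm_cast
  calc P.S y w * -(P.T y w * P.dS y w * P.T y w) + P.dS y w * P.T y w
      = -((P.S y w * P.T y w) * P.dS y w * P.T y w) + P.dS y w * P.T y w := by noncomm_ring
    _ = 0 := by rw [h]; noncomm_ring

theorem dual_T_mul_dual_S {w : B} (hw : IsUnit (P.S y w)) :
    dual (P.T y w : A) (P.dT y w) * dual (P.S y w : A) (P.dS y w) = 1 := by
  have h : P.T y w * P.S y w = 1 := Ring.inverse_mul_cancel _ hw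
  rw [dual_mul, ← dual_one_zero]
  norm_cast
  rw [dT, h]
  congr 1
  norm_cast
  calc P.T y w * P.dS y w + -(P.T y w * P.dS y w * P.T y w) * P.S y w
      = P.T y w * P.dS y w - P.T y w * P.dS y w * (P.T y w * P.S y w) := by noncomm_ring
    _ = 0 := by rw [h]; noncomm_ring

theorem dual_twist (w : B) :
    dual (P.twist y w : A) (P.dtwist y w) =
      dual (P.T y w : A) (P.dT y w) * dual (w : A) 0 * dual (P.S y w : A) (P.dS y w) := by
  rw [dual_mul, dual_mul, twist, dtwist]
  norm_cast
  simp

theorem eventually_dualE_dualRes_mul (h : P.InfFree x y) (hx : IsUnit (P.E x))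
    (hy : IsUnit (P.E y)) :
    ∀ᶠ w in 𝓝 (0 : B), P.dualE (dualRes (x * y) (P.chiMul x y w) (P.dchiMul x y w)) =
      1 + dual (w : A) 0 := by
  filter_upwards [eventually_leftCentered hx hy, eventually_rightCentered hy,
    eventually_norm_centered_lt hx hy, P.eventually_isUnit_S hy, P.eventually_S_eq hy,
    P.eventually_dS_eq hy, P.eventually_chi_eq hy, P.eventually_dchi_eq hy,
    eventually_isUnit_one_add, P.eventually_isUnit_one_sub_chi hy,
    (P.tendsto_twist hy).eventually (P.eventually_isUnit_one_sub_chi hx),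
    (tendsto_chiMul hx hy).eventually (eventually_isUnit_one_sub (x * y))]
    with w hp hq hpq hS hSe hdSe hχ hdχ hw hyu hxu hxyu
  have hB : ∀ i, (B : Set A) ⊆ (![algOver B x, algOver B y] i : Subalgebra ℂ A) := by
    simp [Fin.forall_fin_two, coe_subset_algOver]
  have key := h.dualE_geometric hB (i := 0) (j := 1) (by simp) hp.1 hq.1 hp.2 hq.2 hpq w
  have hSS := dual_S_mul_dual_T hS
  have hSS' := dual_T_mul_dual_S hS
  have hWi : (1 + dual (w : A) 0) * dual ((Ring.inverse (1 + w) : B) : A) (0 : B) = 1 := by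
    have := Ring.mul_inverse_cancel _ hw
    rw [← dual_one_zero, dual_add, dual_mul]
    norm_cast
    rw [this]
    simp
  have hWi' : dual ((Ring.inverse (1 + w) : B) : A) (0 : B) * (1 + dual (w : A) 0) = 1 := by
    have := Ring.inverse_mul_cancel _ hw
    rw [← dual_one_zero, dual_add, dual_mul]
    norm_cast
    rw [this]
    simp
  have hfac := resolvent_mul_one_sub (x := dual x 0) (y := dual y 0) (W := dual (w : A) 0)
    (W' := dual (P.twist y w : A) (P.dtwist y w)) (S := dual (P.S y w : A) (P.dS y w))
    (Si := dual (P.T y w : A) (P.dT y w))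
    (U := dual (P.chi x (P.twist y w) : A) (P.dchiTwist x y w))
    (V := dual (P.chi y w : A) (P.dchi y w)) (K := dual (P.kappa y w : A) (P.dkappa y w))
    (Rx := dualRes x (P.chi x (P.twist y w)) (P.dchiTwist x y w))
    (Ry := dualRes y (P.chi y w) (P.dchi y w))
    (Wi := dual ((Ring.inverse (1 + w) : B) : A) (0 : B))
    (by rw [← dual_one_zero, dual_add, dual_mul, hSe, hdSe]; norm_cast; simp) hSS'
    (by rw [dual_twist, ← mul_assoc, ← mul_assoc, hSS, one_mul])
    (by rw [dual_mul, hχ, hdχ]; norm_cast; simp) hWi' hSS hWi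
    (dualRes_mul hxu _) (mul_dualRes hyu _) (dualRes_mul hyu _)
    (G := Ring.inverse (1 - P.leftCentered x y w * P.rightCentered y w))
    (Ring.inverse_mul_cancel _ (isUnit_one_sub_of_norm_lt_one hpq))
  have hL : dual (P.S y w : A) (P.dS y w) *
      dual (P.chi x (P.twist y w) : A) (P.dchiTwist x y w) * (dual x 0 * dual y 0) =
      dual (P.chiMul x y w : A) (P.dchiMul x y w) * dual (x * y) 0 := by
    rw [dual_mul, dual_mul x, chiMul, dchiMul]
    norm_cast
    simp
  rw [hL] at hfac
  -- The factorization yields only a left inverse of `1 - bxy`; the explicit resolvent is a right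
  -- inverse, so the two agree.
  rw [← left_inv_eq_right_inv hfac (mul_dualRes hxyu _)]
  exact key

end CStarOVISpace

namespace CStarOVISpace

open TrivSqZeroExt

variable {A : Type*} [CStarAlgebra A] [PartialOrder A] [StarOrderedRing A]
  {B : StarSubalgebra ℂ A} {P : CStarOVISpace A B} [IsClosed (B : Set A)] {x y z : A}

/-! ### The transforms of a product -/

theorem InfFree.eventually_chi_mul (h : P.InfFree x y) (hx : IsUnit (P.E x))
    (hy : IsUnit (P.E y)) :
    ∀ᶠ w in 𝓝 (0 : B), P.chi (x * y) w = P.chiMul x y w ∧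
      P.dchi (x * y) w = P.dchiMul x y w := by
  have hxy := h.isUnit_E_mul hx hy
  filter_upwards [eventually_dualE_dualRes_mul h hx hy,
    (tendsto_chiMul hx hy).eventually (P.chi_spec hxy).2.2.2,
    P.eventually_fderiv_psi_chi hxy,
    (tendsto_chiMul hx hy).eventually (eventually_isUnit_one_sub (x * y))] with w h1 h2 h3 h4
  rw [dualE_apply, dualRes, fst_dual, snd_dual, ← dual_one_zero, dual_add, zero_add] at h1
  have hfst : P.E (res (x * y) (P.chiMul x y w)) = 1 + w := by
    have := congrArg fst h1
    rw [fst_dual, fst_dual] at this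
    exact_mod_cast this
  have hsnd : P.dpsi (x * y) (P.chiMul x y w) +
      fderiv ℂ (P.psi (x * y)) (P.chiMul x y w) (P.dchiMul x y w) = 0 := by
    have := congrArg snd h1
    rw [snd_dual, snd_dual] at this
    rw [dpsi_eq_res, P.fderiv_psi h4]
    exact_mod_cast this
  rw [psi_eq_res, hfst, add_sub_cancel_left] at h2
  refine ⟨h2, ?_⟩
  -- The `ε`-part is the linearized inverse equation, solved by applying the derivative of `χ`,
  -- which inverts that of `ψ`.
  rw [dchi, h2, eq_neg_of_add_eq_zero_left hsnd, map_neg, neg_neg, ← h2, (h3 _).2]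

theorem eventually_mul_S_eq_mul_twist (hy : IsUnit (P.E y)) :
    ∀ᶠ w in 𝓝 (0 : B), w * P.S y w = P.S y w * P.twist y w ∧
      w * P.dS y w = P.S y w * P.dtwist y w + P.dS y w * P.twist y w := by
  filter_upwards [P.eventually_isUnit_S hy] with w hw
  have h : P.S y w * P.T y w = 1 := Ring.mul_inverse_cancel _ hw
  rw [twist, dtwist, dT]
  refine ⟨?_, ?_⟩
  · rw [← mul_assoc, ← mul_assoc, h, one_mul]
  · calc w * P.dS y w = (P.S y w * P.T y w) * w * P.dS y w -
          (P.S y w * P.T y w) * P.dS y w * P.T y w * w * P.S y w +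
            P.dS y w * P.T y w * w * P.S y w := by rw [h]; noncomm_ring
      _ = _ := by noncomm_ring

theorem eventually_mul_S (hz : IsUnit (P.E z)) :
    ∀ᶠ w in 𝓝 (0 : B), w * P.S z w = (1 + w) * P.chi z w :=
  (P.transformsDefined hz).isQuotient_S.2

theorem eventually_mul_dS (hz : IsUnit (P.E z)) :
    ∀ᶠ w in 𝓝 (0 : B), w * P.dS z w = (1 + w) * P.dchi z w := by
  filter_upwards [(P.transformsDefined hz).isQuotient_dS.2] with w hw
  rw [hw, dsNum, dchi, mul_neg]

/-- Differentiates `w S(w) = (1 + w) χ(w)`. It relates the derivatives of `S` and `χ` without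
dividing by `w`. -/
theorem eventually_fderiv_mul_S (hz : IsUnit (P.E z)) :
    ∀ᶠ w in 𝓝 (0 : B), ∀ v : B, v * P.S z w + w * fderiv ℂ (P.S z) w v =
      v * P.chi z w + (1 + w) * fderiv ℂ (P.chi z) w v := by
  filter_upwards [(eventually_mul_S hz).eventually_nhds,
    (P.analyticAt_S hz).eventually_analyticAt, (P.chi_spec hz).2.1.eventually_analyticAt]
    with w h1 h2 h3 v
  have d1 := (hasFDerivAt_id (𝕜 := ℂ) w).mul' h2.differentiableAt.hasFDerivAt
  have d2 := ((hasFDerivAt_id (𝕜 := ℂ) w).const_add 1).mul' h3.differentiableAt.hasFDerivAt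
  have e := d1.unique (d2.congr_of_eventuallyEq h1)
  have := DFunLike.congr_fun e v
  simp at this
  rw [add_comm, this, add_comm]

/-- Since `w` may be singular, the identity is proved after left multiplication by `w`, using `w
S_y(w) = S_y(w) v` for the twisted argument `v`; uniqueness of analytic quotients then removes `w`.
-/
theorem InfFree.eventually_S_mul (h : P.InfFree x y) (hx : IsUnit (P.E x))
    (hy : IsUnit (P.E y)) :
    ∀ᶠ w in 𝓝 (0 : B), P.S (x * y) w = P.S y w * P.S x (P.twist y w) := by
  refine leftQuotient_eventuallyEq ⟨(P.analyticAt_S hy).mul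
    ((P.analyticAt_S hx).comp_of_eq (P.analyticAt_twist hy) P.twist_zero), ?_⟩
  filter_upwards [h.eventually_chi_mul hx hy, eventually_mul_S_eq_mul_twist hy,
    (P.tendsto_twist hy).eventually (eventually_mul_S hx)] with w h1 h2 h3
  rw [sNum, h1.1, chiMul]
  set s := P.S y w
  set v := P.twist y w
  calc w * (s * P.S x v) = (w * s) * P.S x v := by noncomm_ring
    _ = s * (v * P.S x v) := by rw [h2.1]; noncomm_ring
    _ = s * P.chi x v + (s * v) * P.chi x v := by rw [h3]; noncomm_ring
    _ = (1 + w) * (s * P.chi x v) := by rw [← h2.1]; noncomm_ring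

/-- The `ε`-coefficient of the product rule for `S`: each factor and the twisted argument is varied
in turn. The factor `w` is again removed by uniqueness of quotients. -/
theorem InfFree.eventually_dS_mul (h : P.InfFree x y) (hx : IsUnit (P.E x))
    (hy : IsUnit (P.E y)) :
    ∀ᶠ w in 𝓝 (0 : B), P.dS (x * y) w =
      P.S y w * (fderiv ℂ (P.S x) (P.twist y w) (P.dtwist y w) + P.dS x (P.twist y w)) +
        P.dS y w * P.S x (P.twist y w) := by
  have ht := P.analyticAt_twist hy
  refine leftQuotient_eventuallyEq ⟨((P.analyticAt_S hy).mul ((analyticAt_clm_apply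
    ((P.analyticAt_S hx).fderiv.comp_of_eq ht P.twist_zero) (P.analyticAt_dtwist hy)).add
      ((P.analyticAt_dS hx).comp_of_eq ht P.twist_zero))).add ((P.analyticAt_dS hy).mul
        ((P.analyticAt_S hx).comp_of_eq ht P.twist_zero)), ?_⟩
  filter_upwards [h.eventually_chi_mul hx hy, eventually_mul_S_eq_mul_twist hy,
    (P.tendsto_twist hy).eventually (eventually_mul_S hx),
    (P.tendsto_twist hy).eventually (eventually_mul_dS hx),
    (P.tendsto_twist hy).eventually (eventually_fderiv_mul_S hx)] with w h1 h2 h3 h4 h5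
  have h5 := h5 (P.dtwist y w)
  rw [dsNum, ← mul_neg, ← dchi, h1.2, dchiMul, dchiTwist]
  set s := P.S y w
  set ds := P.dS y w
  set v := P.twist y w
  set c := P.dtwist y w
  set X := P.chi x v
  set dX := P.dchi x v
  set X' := fderiv ℂ (P.chi x) v c
  set S' := fderiv ℂ (P.S x) v c
  calc w * (s * (S' + P.dS x v) + ds * P.S x v)
      = (w * s) * (S' + P.dS x v) + (w * ds) * P.S x v := by noncomm_ring
    _ = s * (c * P.S x v + v * S') + s * (v * P.dS x v) + ds * (v * P.S x v) := by
        rw [h2.1, h2.2]; noncomm_ring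
    _ = (s * c + ds * v) * X + ds * X + (s + s * v) * (X' + dX) := by
        rw [h3, h4, h5]; noncomm_ring
    _ = (1 + w) * (s * (X' + dX) + ds * X) := by rw [← h2.1, ← h2.2]; noncomm_ring

theorem eventually_fderiv_T (hz : IsUnit (P.E z)) :
    ∀ᶠ w in 𝓝 (0 : B), ∀ v : B,
      fderiv ℂ (P.T z) w v = -(P.T z w * fderiv ℂ (P.S z) w v * P.T z w) := by
  filter_upwards [P.eventually_isUnit_S hz, (P.analyticAt_S hz).eventually_analyticAt]
    with w h1 h2 v
  obtain ⟨u, hu⟩ := h1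
  have d := hasFDerivAt_ringInverse (𝕜 := ℂ) u
  rw [hu] at d
  have d' : HasFDerivAt (P.T z) _ w := d.comp w h2.differentiableAt.hasFDerivAt
  rw [d'.fderiv]
  simp [T, ← hu]

theorem InfFree.eventually_dT_mul (h : P.InfFree x y) (hx : IsUnit (P.E x))
    (hy : IsUnit (P.E y)) :
    ∀ᶠ w in 𝓝 (0 : B), P.dT (x * y) w =
      P.T x (P.twist y w) * P.dT y w +
        fderiv ℂ (P.T x) (P.twist y w) (P.dtwist y w) * P.T y w +
          P.dT x (P.twist y w) * P.T y w := by
  filter_upwards [h.eventually_S_mul hx hy, h.eventually_dS_mul hx hy,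
    P.eventually_isUnit_S hy, (P.tendsto_twist hy).eventually (P.eventually_isUnit_S hx),
    (P.tendsto_twist hy).eventually (eventually_fderiv_T hx)] with w h1 h2 h3 h4 h5
  have hT : P.T (x * y) w = P.T x (P.twist y w) * P.T y w := by
    rw [T, h1, T, T, Ring.inverse_mul (Or.inl h3)]
  have e1 : P.T y w * P.S y w = 1 := Ring.inverse_mul_cancel _ h3
  have e2 : P.S x (P.twist y w) * P.T x (P.twist y w) = 1 := Ring.mul_inverse_cancel _ h4
  rw [dT, hT, h2, h5, dT, dT]
  set s := P.S y w
  set ds := P.dS y w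
  set t := P.T y w
  set v := P.twist y w
  set r := P.T x v
  set q := P.S x v
  set S' := fderiv ℂ (P.S x) v (P.dtwist y w)
  calc -(r * t * (s * (S' + P.dS x v) + ds * q) * (r * t))
      = -(r * (t * s) * (S' + P.dS x v) * r * t) - r * t * ds * (q * r) * t := by noncomm_ring
    _ = _ := by rw [e1, e2]; noncomm_ring

end CStarOVISpace

end

theorem mainTheorem1 {A : Type*} [CStarAlgebra A] [PartialOrder A] [StarOrderedRing A]
    (B : StarSubalgebra ℂ A) [IsClosed (B : Set A)] (P : CStarOVISpace A B)
    (x y : A) (hx : IsSelfAdjoint x) (hy : IsSelfAdjoint y) (hxy : P.InfFree x y)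
    (hEx : IsUnit (P.E x)) (hEy : IsUnit (P.E y)) :
    (P.TransformsDefined x ∧ P.TransformsDefined y ∧ P.TransformsDefined (x * y)) ∧
    ∃ ε : ℝ, 0 < ε ∧ ∀ w : B, ‖w‖ < ε →
      let Ty : B := P.T y w
      let dTy : B := P.dT y w
      let Tyi : B := Ring.inverse Ty
      let w' : B := Ty * w * Tyi
      let C : B := -(Ty * w * Tyi * dTy * Tyi) + dTy * w * Tyi
      P.dT (x * y) w =
        P.T x w' * dTy + fderiv ℂ (P.T x) w' C * Ty + P.dT x w' * Ty := by
  refine ⟨⟨P.transformsDefined hEx, P.transformsDefined hEy,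
    P.transformsDefined (hxy.isUnit_E_mul hEx hEy)⟩, ?_⟩
  obtain ⟨ε, hε, hw⟩ := Metric.eventually_nhds_iff.1
    ((hxy.eventually_dT_mul hEx hEy).and (P.eventually_isUnit_S hEy))
  refine ⟨ε, hε, fun w hwε => ?_⟩
  obtain ⟨h1, h2⟩ := hw (y := w) (by simpa using hwε)
  intro Ty dTy Tyi w' C
  have e0 : Tyi = P.S y w := Ring.inverse_inverse h2
  have e1 : w' = P.twist y w := by simp only [w', e0, Ty, CStarOVISpace.twist]
  have e2 : P.S y w * Ty = 1 := Ring.mul_inverse_cancel _ h2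
  have e3 : Ty * P.S y w = 1 := Ring.inverse_mul_cancel _ h2
  -- Since `Tyi = S_y(w)` and `dTy = -Ty ∂S_y(w) Ty`, the product `Tyi * dTy * Tyi` collapses to
  -- `-∂S_y(w)`. Thus `C` is the `ε`-part of `T_y(w) w T_y(w)⁻¹`.
  have e4 : C = P.dtwist y w := by
    have e5 : dTy = -(Ty * P.dS y w * Ty) := rfl
    calc C = Ty * w * (P.S y w * Ty) * P.dS y w * (Ty * P.S y w) + dTy * w * P.S y w := by
          simp only [C, e0]
          conv_lhs => enter [1]; rw [e5]
          noncomm_ring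
      _ = _ := by rw [e2, e3, mul_one, mul_one]; rfl
  rw [e1, e4]
  exact h1
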